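/- **Adaptive lower bounds for the unit ball and hypercubes.** Let $d\ge 1$ and let $\mathcal X\subset\mathbb R^d$ be the unit ball $\{x:\|x\|_2\le 1\}$, the hypercube $\{-1,1\}^d$ or the hypercube $\{0,1\}^d$. For an unknown reward vector $\theta\in\mathbb R^d$, a (possibly randomized, possibly adaptive) algorithm chooses in each round $t$ an arm $x_t\in\mathcal X$ as a function of its internal randomness and the past rewards, and observes $y_t=\langle x_t,\theta\rangle+\eta_t$, where the $\eta_t$ are i.i.d. $\mathcal N(0,1)$ and independent of the internal randomness. At a stopping time $\tau\in\mathbb N\cup\{\infty\}$ of its choice it outputs an arm $\hat x\in\mathcal X$. It is $(\varepsilon,\delta)$-PAC if for every $\theta\in\mathbb R^d$, with probability at least $1-\delta$, it stops and $\max_{x\in\mathcal X}\langle x-\hat x,\theta\rangle\le\varepsilon$. Let $\mathbb E_\theta[\tau]$ be its expected number of samples under $\theta$. There are absolute constants $c,C>0$ such that for all $d\ge 1$ and each of these three sets $\mathcal X$ the following hold. 1. Let $0<H_1\le H_2$. If for all $\varepsilon\in(0,1]$ and $\delta\in(0,1)$ there is an $(\varepsilon,\delta)$-PAC algorithm with $\mathbb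 E_\theta[\tau]\le \frac{H_1\log(1/\delta)+H_2}{\varepsilon^2}$ for all $\theta\in\mathbb R^d$ (for instance, one that always uses at most this many samples), then $H_2\ge c\,d^2$. 2. For all $\varepsilon\in(0,1]$ and $\delta\in(0,1/16)$, every $(\varepsilon,\delta)$-PAC algorithm satisfies, for some $\theta\in\mathbb R^d$, $$\mathbb E_\theta[\tau]\ \ge\ c\left(\frac{d\log(1/\delta)}{\varepsilon^2}+\frac{d^2}{\varepsilon^2}\right).$$ 3. This matches the non-adaptive upper bound: for all $\varepsilon\in(0,1]$ and $\delta\in(0,1)$ there is an $(\varepsilon,\delta)$-PAC algorithm that pulls a deterministic sequence of $T$ arms and then stops, with $$T\ \le\ C\left(\frac{d\log(1/\delta)}{\varepsilon^2}+\frac{d^2}{\varepsilon^2}\right).$$ -/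

import Mathlib

open MeasureTheory ProbabilityTheory
open scoped ENNReal

namespace LinearBandit

/-- `ℝ^d` with its Euclidean structure. -/
abbrev Vec (d : ℕ) : Type := EuclideanSpace ℝ (Fin d)

/-- The unit `ℓ₂` ball of `ℝ^d`. -/
def unitBall (d : ℕ) : Set (Vec d) := {x | ‖x‖ ≤ 1}

/-- The hypercube `{-1, 1}^d`. -/
def signCube (d : ℕ) : Set (Vec d) := {x | ∀ i, x i = -1 ∨ x i = 1}

/-- The hypercube `{0, 1}^d`. -/
def binaryCube (d : ℕ) : Set (Vec d) := {x | ∀ i, x i = 0 ∨ x i = 1}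

/-- A (possibly adaptive, possibly randomized) pure-exploration algorithm for the arm set `X`.
It draws an internal random seed `u` once. After it has seen the rewards `y = (y₀, …, y_{t-1})`
of the first `t` rounds, it halts if `(u, y) ∈ halt t`, and then outputs `recommend t u y`;
otherwise it pulls the arm `arm t u y` in round `t`. (Earlier arms are functions of `u` and of
earlier rewards, so they are available to all three rules.) -/
structure Algorithm {d : ℕ} (X : Set (Vec d)) where
  Seed : Type
  [seedSpace : MeasurableSpace Seed]
  seedLaw : Measure Seed
  [seedProb : IsProbabilityMeasure seedLaw]
  arm : (t : ℕ) → Seed → (Fin t → ℝ) → Vec d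
  arm_measurable : ∀ t, Measurable fun p : Seed × (Fin t → ℝ) => arm t p.1 p.2
  arm_mem : ∀ t u y, arm t u y ∈ X
  halt : (t : ℕ) → Set (Seed × (Fin t → ℝ))
  halt_measurable : ∀ t, MeasurableSet (halt t)
  recommend : (t : ℕ) → Seed → (Fin t → ℝ) → Vec d
  recommend_measurable : ∀ t, Measurable fun p : Seed × (Fin t → ℝ) => recommend t p.1 p.2
  recommend_mem : ∀ t u y, recommend t u y ∈ X

namespace Algorithm

variable {d : ℕ} {X : Set (Vec d)} (A : Algorithm X)

instance : MeasurableSpace A.Seed := A.seedSpace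

instance : IsProbabilityMeasure A.seedLaw := A.seedProb

/-- The sample space: the internal seed, and the noise `η₀, η₁, …` of all rounds. -/
abbrev Sample : Type := A.Seed × (ℕ → ℝ)

/-- The seed has law `seedLaw`, the noise variables are i.i.d. standard Gaussian, and the two
are independent. -/
noncomputable def law : Measure A.Sample :=
  A.seedLaw.prod (Measure.infinitePi fun _ : ℕ => gaussianReal 0 1)

/-- The rewards of the first `t` rounds, `y_s = ⟨x_s, θ⟩ + η_s` for `s < t`, where
`x_s = arm s u (y₀, …, y_{s-1})`. -/
noncomputable def rewards (θ : Vec d) (ω : A.Sample) : (t : ℕ) → Fin t → ℝ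
  | 0 => Fin.elim0
  | t + 1 => Fin.snoc (α := fun _ => ℝ) (rewards θ ω t)
      (inner ℝ (A.arm t ω.1 (rewards θ ω t)) θ + ω.2 t)

/-- The number of samples taken before stopping (`⊤` if the algorithm never halts). -/
noncomputable def numSamples (θ : Vec d) (ω : A.Sample) : ℕ∞ :=
  ⨅ (t : ℕ) (_ : (ω.1, A.rewards θ ω t) ∈ A.halt t), (t : ℕ∞)

/-- The expected number of samples when the reward vector is `θ`. -/
noncomputable def expectedSamples (θ : Vec d) : ℝ≥0∞ :=
  ∫⁻ ω, (A.numSamples θ ω : ℝ≥0∞) ∂A.law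

/-- The event that the algorithm stops, and outputs an `ε`-best arm. -/
def successEvent (θ : Vec d) (ε : ℝ) : Set A.Sample :=
  {ω | ∃ t : ℕ, A.numSamples θ ω = t ∧
    ∀ x ∈ X, inner ℝ (x - A.recommend t ω.1 (A.rewards θ ω t)) θ ≤ ε}

/-- `A` is `(ε, δ)`-PAC: for every reward vector it outputs an `ε`-best arm with probability at
least `1 - δ`. -/
def IsPAC (ε δ : ℝ) : Prop :=
  ∀ θ : Vec d, ENNReal.ofReal (1 - δ) ≤ A.law (A.successEvent θ ε)

/-- `A` is a non-adaptive fixed-design algorithm of length `T`: it pulls a deterministic sequence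
of `T` arms, and stops after exactly `T` rounds. -/
def IsFixedDesign (T : ℕ) : Prop :=
  (∃ x : ℕ → Vec d, ∀ t u y, A.arm t u y = x t) ∧
    ∀ t u y, (u, y) ∈ A.halt t ↔ t = T

end Algorithm

end LinearBandit

/-!
# Sample complexity of pure exploration on the unit ball and on hypercubes

**Lower bounds.** All three arm sets are treated through the reward vectors `Δ s`, with
`s ∈ {-1, 1}^d` (`IsSignHard`). The scale is so small that `Δ R ≤ 16 ε / √d`, where `R` is the
radius of the arm set; yet every `ε`-best arm is positive exactly where `s` is, except in at most
an eighth of the coordinates. The two terms of the bound come from two comparisons.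

* `IsSignHard.confidence_le`: under the reward vector `0` the recommendation cannot fit both `s`
  and `-s`, while under `Δ s` it fails to fit `s` with probability at most `δ`. To tell the two
  situations apart takes information of order `log (1/δ)`, and one sample contributes
  `⟨x, Δ s⟩² / 2`, which is at most `(Δ R)² / 2 = O(ε² / d)` on average over `s`.
* `IsSignHard.dimension_le`: a correct algorithm recovers most of the signs, hence has to tell
  `Δ s` from its neighbour with sign `i` reversed, for most `i`. One sample contributes
  `2 Δ² x_i²` to this, which sums to `O(ε² / d)` over all `d` coordinates.

Both rest on the transportation inequality `Algorithm.transport`,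
`a P_θ(E) ≤ (exp a - 1) P_θ'(E) + (1/2) E_θ ∑_{t < τ} ⟨x_t, θ' - θ⟩²` for events `E` of stopping
with a recommendation in a given set. With the logarithm `L` of the likelihood ratio of the
stopped histories, it is the expectation of `u + 1 ≤ exp u` at `u = a 1_E + L`. Adaptivity is
harmless since the coefficients of the noise in `L` are predictable (`Algorithm.IsPredictable`):
the noise of round `t` can be resampled without changing the history before it
(`Algorithm.lintegral_resample`).

The bound on `H₂` is the lower bound at `ε = 1` and a constant `δ`, where `H₁ ≤ H₂` makes the
`log (1/δ)` term of the assumed bound a multiple of `H₂`.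

**Upper bound.** The first `d` columns of a Hadamard matrix (`exists_orthogonal_signs`) give
`O(d)` arms with a linear estimator of `θ` whose error is the same in every direction. After
repetition, the error `Z` is Gaussian with variance `v = O(ε² / (R² (d + log (1/δ))))` in every
direction, so that `E exp(‖Z‖² / (4 v)) ≤ 2^(d/2)`, and `2 R ‖Z‖ ≤ ε` with probability at least
`1 - δ`. The best arm for the estimate then is `ε`-best (`isPAC_fixedDesign`,
`exists_fixedDesign_isPAC`).
-/

/-! ### Resampling one coordinate of an infinite product -/

/-- The law of an infinite product is unchanged if coordinate `i` is replaced by an independent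
copy. -/
theorem MeasureTheory.Measure.measurePreserving_update_infinitePi {ι : Type*} [DecidableEq ι]
    {E : ι → Type*} [∀ i, MeasurableSpace (E i)] (μ : ∀ i, Measure (E i))
    [∀ i, IsProbabilityMeasure (μ i)] (i : ι) :
    MeasurePreserving (fun p : (∀ i, E i) × E i => Function.update p.1 i p.2)
      ((Measure.infinitePi μ).prod (μ i)) (Measure.infinitePi μ) := by
  have hm : Measurable fun p : (∀ i, E i) × E i => Function.update p.1 i p.2 :=
    measurable_update'
  refine ⟨hm, ?_⟩
  refine Measure.eq_infinitePi (μ := μ) fun s t ht => ?_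
  have hms : MeasurableSet (Set.pi (s : Set ι) t) :=
    MeasurableSet.pi s.countable_toSet fun j _ => ht j
  rw [Measure.map_apply hm hms]
  by_cases his : i ∈ s
  · have hpre : (fun p : (∀ i, E i) × E i => Function.update p.1 i p.2) ⁻¹' Set.pi (s : Set ι) t
        = (Set.pi ((s.erase i : Finset ι) : Set ι) t) ×ˢ t i := by
      ext p
      simp only [Set.mem_preimage, Set.mem_pi, Set.mem_prod, Finset.mem_coe, Finset.mem_erase]
      constructor
      · intro h
        refine ⟨fun j hj => ?_, ?_⟩
        · simpa [Function.update_of_ne hj.1] using h j hj.2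
        · simpa using h i his
      · rintro ⟨h1, h2⟩ j hj
        by_cases hji : j = i
        · subst hji; simpa using h2
        · simpa [Function.update_of_ne hji] using h1 j ⟨hji, hj⟩
    rw [hpre, Measure.prod_prod, Measure.infinitePi_pi _ (fun j _ => ht j),
      Finset.prod_erase_mul _ _ his]
  · have hpre : (fun p : (∀ i, E i) × E i => Function.update p.1 i p.2) ⁻¹' Set.pi (s : Set ι) t
        = (Set.pi (s : Set ι) t) ×ˢ Set.univ := by
      ext p
      simp only [Set.mem_preimage, Set.mem_pi, Set.mem_prod, Finset.mem_coe, Set.mem_univ,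
        and_true]
      refine forall₂_congr fun j hj => ?_
      have hji : j ≠ i := fun h => his (h ▸ hj)
      rw [Function.update_of_ne hji]
    rw [hpre, Measure.prod_prod, Measure.infinitePi_pi _ (fun j _ => ht j), measure_univ, mul_one]

/-! ### Exponential tilting of the standard Gaussian -/

theorem lintegral_gaussianReal_shift (f : ℝ → ℝ≥0∞) (hf : Measurable f) (b : ℝ) :
    ∫⁻ z, f (b + z) ∂gaussianReal 0 1
      = ∫⁻ z, f z * ENNReal.ofReal (Real.exp (b * z - b ^ 2 / 2)) ∂gaussianReal 0 1 := by
  have h1 : ∫⁻ z, f (b + z) ∂gaussianReal 0 1 = ∫⁻ z, f z ∂gaussianReal b 1 := by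
    have := gaussianReal_map_const_add (μ := 0) (v := 1) b
    rw [zero_add] at this
    rw [← this, lintegral_map hf (by fun_prop)]
  rw [h1, gaussianReal_of_var_ne_zero _ one_ne_zero, gaussianReal_of_var_ne_zero _ one_ne_zero,
    lintegral_withDensity_eq_lintegral_mul _ (measurable_gaussianPDF _ _) hf,
    lintegral_withDensity_eq_lintegral_mul _ (measurable_gaussianPDF _ _) (by fun_prop)]
  refine lintegral_congr fun z => ?_
  simp only [Pi.mul_apply, gaussianPDF, gaussianPDFReal]
  rw [mul_comm (f z), ← mul_assoc, ← ENNReal.ofReal_mul (by positivity), mul_assoc (_⁻¹),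
    ← Real.exp_add]
  congr 4
  simp only [NNReal.coe_one]
  ring

theorem lintegral_exp_gaussianReal_tilt (b : ℝ) :
    ∫⁻ z, ENNReal.ofReal (Real.exp (b * z - b ^ 2 / 2)) ∂gaussianReal 0 1 = 1 := by
  have := lintegral_gaussianReal_shift (fun _ => 1) measurable_const b
  simpa using this.symm

namespace LinearBandit

/-! ### The interaction of an algorithm with a reward vector -/

theorem measurable_snoc {α : Type*} [MeasurableSpace α] {t : ℕ} {f : α → Fin t → ℝ} {g : α → ℝ}
    (hf : Measurable f) (hg : Measurable g) :
    Measurable fun a => (Fin.snoc (α := fun _ => ℝ) (f a) (g a) : Fin (t + 1) → ℝ) := by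
  refine measurable_pi_lambda _ fun i => ?_
  refine Fin.lastCases ?_ (fun j => ?_) i
  · simpa using hg
  · simp only [Fin.snoc_castSucc]
    exact (measurable_pi_apply j).comp hf

namespace Algorithm

variable {d : ℕ} {X : Set (Vec d)} (A : Algorithm X)

instance : IsProbabilityMeasure A.law := by unfold law; infer_instance

/-- The round-`t` noise may be replaced by a fresh standard Gaussian. -/
theorem measurePreserving_resample (t : ℕ) :
    MeasurePreserving (fun p : A.Sample × ℝ => ((p.1.1, Function.update p.1.2 t p.2) : A.Sample))
      (A.law.prod (gaussianReal 0 1)) A.law := by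
  have h := (MeasurePreserving.id A.seedLaw).prod
    (Measure.measurePreserving_update_infinitePi (fun _ : ℕ => gaussianReal 0 1) t)
  have h2 := MeasureTheory.measurePreserving_prodAssoc A.seedLaw
    (Measure.infinitePi fun _ : ℕ => gaussianReal 0 1) (gaussianReal 0 1)
  exact h.comp h2

theorem lintegral_resample (t : ℕ) {f : A.Sample → ℝ≥0∞} (hf : Measurable f) :
    ∫⁻ ω, f ω ∂A.law
      = ∫⁻ ω, ∫⁻ z, f (ω.1, Function.update ω.2 t z) ∂gaussianReal 0 1 ∂A.law := by
  have h := A.measurePreserving_resample t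
  rw [← h.lintegral_comp hf, lintegral_prod]
  exact (hf.comp h.measurable).aemeasurable

theorem rewards_succ (θ : Vec d) (ω : A.Sample) (t : ℕ) :
    A.rewards θ ω (t + 1) = Fin.snoc (α := fun _ => ℝ) (A.rewards θ ω t)
      (inner ℝ (A.arm t ω.1 (A.rewards θ ω t)) θ + ω.2 t) := rfl

theorem rewards_congr (θ : Vec d) (u : A.Seed) {η η' : ℕ → ℝ} {t : ℕ}
    (h : ∀ i < t, η i = η' i) : A.rewards θ (u, η) t = A.rewards θ (u, η') t := by
  induction t with
  | zero => rfl
  | succ t ih =>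
    rw [rewards_succ, rewards_succ, ih fun i hi => h i (hi.trans t.lt_succ_self)]
    simp only [h t t.lt_succ_self]

theorem rewards_update (θ : Vec d) (ω : A.Sample) {s t : ℕ} (hst : s ≤ t) (z : ℝ) :
    A.rewards θ (ω.1, Function.update ω.2 t z) s = A.rewards θ ω s :=
  A.rewards_congr θ ω.1 fun i hi => Function.update_of_ne (by omega) _ _

theorem measurable_rewards (θ : Vec d) (t : ℕ) : Measurable fun ω => A.rewards θ ω t := by
  induction t with
  | zero => exact measurable_const
  | succ t ih =>
    simp only [rewards_succ]
    refine measurable_snoc ih (Measurable.add ?_ (by fun_prop))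
    have := (A.arm_measurable t).comp (measurable_fst.prodMk ih)
    exact this.inner measurable_const

theorem rewards_castLE (θ : Vec d) (ω : A.Sample) {s t : ℕ} (hst : s ≤ t) (i : Fin s) :
    A.rewards θ ω t (Fin.castLE hst i) = A.rewards θ ω s i := by
  induction t, hst using Nat.le_induction with
  | base => rfl
  | succ t hst ih =>
    rw [rewards_succ, ← ih]
    exact Fin.snoc_castSucc (α := fun _ => ℝ) _ _ (Fin.castLE hst i)

/-- The arm pulled in round `t`. -/
noncomputable def pulled (θ : Vec d) (t : ℕ) (ω : A.Sample) : Vec d :=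
  A.arm t ω.1 (A.rewards θ ω t)

theorem measurable_pulled (θ : Vec d) (t : ℕ) : Measurable (A.pulled θ t) :=
  (A.arm_measurable t).comp (measurable_fst.prodMk (A.measurable_rewards θ t))

theorem pulled_mem (θ : Vec d) (t : ℕ) (ω : A.Sample) : A.pulled θ t ω ∈ X := A.arm_mem _ _ _

theorem pulled_update (θ : Vec d) (ω : A.Sample) {s t : ℕ} (hst : s ≤ t) (z : ℝ) :
    A.pulled θ s (ω.1, Function.update ω.2 t z) = A.pulled θ s ω := by
  simp only [pulled, A.rewards_update θ ω hst]

/-- The event that the algorithm has not stopped by the beginning of round `t`, when the rewards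
of the first `t` rounds are known; in this case it pulls an arm in round `t`. -/
def running (θ : Vec d) (t : ℕ) : Set A.Sample :=
  {ω | ∀ j ≤ t, (ω.1, A.rewards θ ω j) ∉ A.halt j}

theorem measurableSet_running (θ : Vec d) (t : ℕ) : MeasurableSet (A.running θ t) := by
  have : A.running θ t = ⋂ j ∈ Set.Iic t, {ω | (ω.1, A.rewards θ ω j) ∉ A.halt j} := by
    ext ω; simp [running]
  rw [this]
  refine MeasurableSet.biInter (Set.to_countable _) fun j _ => ?_
  exact ((measurable_fst.prodMk (A.measurable_rewards θ j)) (A.halt_measurable j)).compl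

theorem mem_running_update (θ : Vec d) (ω : A.Sample) {s t : ℕ} (hst : s ≤ t) (z : ℝ) :
    ((ω.1, Function.update ω.2 t z) : A.Sample) ∈ A.running θ s ↔ ω ∈ A.running θ s := by
  refine forall₂_congr fun j hj => ?_
  rw [A.rewards_update θ ω (hj.trans hst)]

/-- The histories after which the algorithm halts for the first time at time `t`. -/
def firstHalt (t : ℕ) : Set (A.Seed × (Fin t → ℝ)) :=
  {p | p ∈ A.halt t ∧ ∀ j, ∀ h : j < t, (p.1, fun i => p.2 (Fin.castLE h.le i)) ∉ A.halt j}

theorem measurableSet_firstHalt (t : ℕ) : MeasurableSet (A.firstHalt t) := by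
  have : A.firstHalt t = A.halt t ∩
      ⋂ j, ⋂ h : j < t, {p | (p.1, fun i => p.2 (Fin.castLE h.le i)) ∉ A.halt j} := by
    ext; simp [firstHalt]
  rw [this]
  refine (A.halt_measurable t).inter ?_
  refine MeasurableSet.iInter fun j => MeasurableSet.iInter fun h => ?_
  have hm : Measurable fun p : A.Seed × (Fin t → ℝ) =>
      (p.1, fun i => p.2 (Fin.castLE h.le i)) := by fun_prop
  exact (hm (A.halt_measurable j)).compl

theorem mem_firstHalt (θ : Vec d) (ω : A.Sample) (t : ℕ) :
    (ω.1, A.rewards θ ω t) ∈ A.firstHalt t ↔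
      (ω.1, A.rewards θ ω t) ∈ A.halt t ∧ ∀ j < t, (ω.1, A.rewards θ ω j) ∉ A.halt j := by
  simp only [firstHalt, Set.mem_ofPred_eq]
  refine and_congr_right fun _ => forall₂_congr fun j hj => ?_
  have : (fun i => A.rewards θ ω t (Fin.castLE hj.le i)) = A.rewards θ ω j :=
    funext fun i => A.rewards_castLE θ ω hj.le i
  rw [this]

theorem numSamples_eq_coe_iff (θ : Vec d) (ω : A.Sample) (t : ℕ) :
    A.numSamples θ ω = t ↔ (ω.1, A.rewards θ ω t) ∈ A.firstHalt t := by
  rw [mem_firstHalt]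
  constructor
  · intro h
    have hlow : ∀ j < t, (ω.1, A.rewards θ ω j) ∉ A.halt j := fun j hj hmem => by
      have : A.numSamples θ ω ≤ j := iInf₂_le j hmem
      rw [h] at this
      exact absurd (by exact_mod_cast this) (not_le.2 hj)
    refine ⟨?_, hlow⟩
    by_contra hmem
    have : ((t + 1 : ℕ) : ℕ∞) ≤ A.numSamples θ ω := by
      refine le_iInf₂ fun j hj => ?_
      have : t < j := by
        rcases lt_trichotomy j t with h1 | h1 | h1
        · exact absurd hj (hlow j h1)
        · exact absurd (h1 ▸ hj) hmem
        · exact h1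
      exact_mod_cast this
    rw [h] at this
    exact absurd (by exact_mod_cast this) (Nat.not_succ_le_self t)
  · rintro ⟨h1, h2⟩
    refine le_antisymm (iInf₂_le t h1) (le_iInf₂ fun j hj => ?_)
    have : t ≤ j := not_lt.1 fun h => h2 j h hj
    exact_mod_cast this

theorem mem_running_iff_lt (θ : Vec d) (ω : A.Sample) (t : ℕ) :
    ω ∈ A.running θ t ↔ (t : ℕ∞) < A.numSamples θ ω := by
  constructor
  · intro h
    have : ((t + 1 : ℕ) : ℕ∞) ≤ A.numSamples θ ω := by
      refine le_iInf₂ fun j hj => ?_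
      have : t < j := not_le.1 fun h' => h j h' hj
      exact_mod_cast this
    exact lt_of_lt_of_le (by exact_mod_cast t.lt_succ_self) this
  · intro h j hj hmem
    have : A.numSamples θ ω ≤ j := iInf₂_le j hmem
    exact absurd (h.trans_le this) (not_lt.2 (by exact_mod_cast hj))

theorem tsum_running_le (θ : Vec d) (ω : A.Sample) :
    ∑' t, (A.running θ t).indicator (fun _ => (1 : ℝ≥0∞)) ω ≤ (A.numSamples θ ω : ℝ≥0∞) := by
  refine ENNReal.tsum_le_of_sum_range_le fun n => ?_
  cases h : A.numSamples θ ω with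
  | top => simp
  | coe k =>
    have : ∀ t ∈ Finset.range n, (A.running θ t).indicator (fun _ => (1 : ℝ≥0∞)) ω
        = if t < k then 1 else 0 := fun t _ => by
      have hk : ω ∈ A.running θ t ↔ t < k := by
        rw [mem_running_iff_lt, h]; exact Nat.cast_lt
      by_cases ht : t < k
      · rw [Set.indicator_of_mem (hk.2 ht), if_pos ht]
      · rw [Set.indicator_of_notMem (mt hk.1 ht), if_neg ht]
    rw [Finset.sum_congr rfl this, Finset.sum_ite, Finset.sum_const_zero, add_zero,
      Finset.sum_const, nsmul_eq_mul, mul_one]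
    have hc : ((Finset.range n).filter (· < k)).card ≤ k := by
      calc _ ≤ (Finset.range k).card := Finset.card_le_card fun t ht => by
            simpa using (Finset.mem_filter.1 ht).2
        _ = k := Finset.card_range k
    simpa using (by exact_mod_cast hc : (((Finset.range n).filter (· < k)).card : ℝ≥0∞) ≤ k)

end Algorithm

namespace Algorithm

variable {d : ℕ} {X : Set (Vec d)} (A : Algorithm X)

/-! ### Exponential tilting by predictable processes -/

/-- A predictable process: `b t` does not depend on the noise of round `t` or later. -/
structure IsPredictable (b : ℕ → A.Sample → ℝ) : Prop where
  measurable : ∀ t, Measurable (b t)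
  update : ∀ {s t : ℕ}, s ≤ t → ∀ (ω : A.Sample) (z : ℝ),
    b s (ω.1, Function.update ω.2 t z) = b s ω

/-- The logarithm of the density of the first `n` noise variables shifted by `b`,
relative to the unshifted ones. -/
noncomputable def logTilt (b : ℕ → A.Sample → ℝ) (n : ℕ) (ω : A.Sample) : ℝ :=
  ∑ s ∈ Finset.range n, (b s ω * ω.2 s - b s ω ^ 2 / 2)

variable {A}

theorem logTilt_succ (b : ℕ → A.Sample → ℝ) (n : ℕ) (ω : A.Sample) :
    A.logTilt b (n + 1) ω = A.logTilt b n ω + (b n ω * ω.2 n - b n ω ^ 2 / 2) :=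
  Finset.sum_range_succ _ _

theorem IsPredictable.measurable_logTilt {b : ℕ → A.Sample → ℝ} (hb : A.IsPredictable b) (n : ℕ) :
    Measurable (A.logTilt b n) := by
  have := hb.measurable
  refine Finset.measurable_fun_sum _ fun s _ => ?_
  have h2 : Measurable fun ω : A.Sample => ω.2 s := by fun_prop
  exact ((this s).mul h2).sub (((this s).pow_const 2).div_const 2)

theorem IsPredictable.logTilt_update {b : ℕ → A.Sample → ℝ} (hb : A.IsPredictable b) {n t : ℕ}
    (hnt : n ≤ t) (ω : A.Sample) (z : ℝ) :
    A.logTilt b n (ω.1, Function.update ω.2 t z) = A.logTilt b n ω := by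
  refine Finset.sum_congr rfl fun s hs => ?_
  have hs' : s < n := Finset.mem_range.1 hs
  rw [hb.update (by omega)]
  simp only [Function.update_of_ne (show s ≠ t by omega)]

theorem IsPredictable.lintegral_exp_logTilt {b : ℕ → A.Sample → ℝ} (hb : A.IsPredictable b)
    (n : ℕ) : ∫⁻ ω, ENNReal.ofReal (Real.exp (A.logTilt b n ω)) ∂A.law = 1 := by
  induction n with
  | zero => simp [logTilt]
  | succ n ih =>
    rw [A.lintegral_resample n (hb.measurable_logTilt (n + 1)).exp.ennreal_ofReal, ← ih]
    refine lintegral_congr fun ω => ?_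
    simp only [logTilt_succ, hb.logTilt_update le_rfl, hb.update le_rfl,
      Function.update_self, Real.exp_add]
    simp_rw [ENNReal.ofReal_mul (Real.exp_nonneg _)]
    rw [lintegral_const_mul _ (by fun_prop), lintegral_exp_gaussianReal_tilt, mul_one]

theorem integrable_noise (t : ℕ) : Integrable (fun ω : A.Sample => ω.2 t) A.law := by
  have h1 : Integrable (fun z : ℝ => z) (gaussianReal 0 1) :=
    (memLp_id_gaussianReal 1).integrable le_rfl
  have h := A.measurePreserving_resample t
  refine (h.integrable_comp
    (by fun_prop : Measurable fun ω : A.Sample => ω.2 t).aestronglyMeasurable).1 ?_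
  have : (fun ω : A.Sample => ω.2 t) ∘
      (fun p : A.Sample × ℝ => ((p.1.1, Function.update p.1.2 t p.2) : A.Sample))
      = fun p => p.2 := by
    funext p; simp
  rw [this]
  exact h1.comp_snd A.law

theorem IsPredictable.integrable_mul_noise {b : ℕ → A.Sample → ℝ} (hb : A.IsPredictable b) {B : ℝ}
    (hB : ∀ t ω, |b t ω| ≤ B) (t : ℕ) : Integrable (fun ω => b t ω * ω.2 t) A.law :=
  (integrable_noise t).bdd_mul (hb.measurable t).aestronglyMeasurable
    (Filter.Eventually.of_forall (hB t))

theorem IsPredictable.integral_mul_noise {b : ℕ → A.Sample → ℝ} (hb : A.IsPredictable b)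
    (t : ℕ) : ∫ ω, b t ω * ω.2 t ∂A.law = 0 := by
  have h := A.measurePreserving_resample t
  have hm : Measurable fun ω : A.Sample => b t ω * ω.2 t :=
    (hb.measurable t).mul (by fun_prop)
  have h2 := integral_map (μ := A.law.prod (gaussianReal 0 1)) h.measurable.aemeasurable
    (f := fun ω : A.Sample => b t ω * ω.2 t) hm.aestronglyMeasurable
  rw [h.map_eq] at h2
  rw [h2]
  simp only [hb.update le_rfl, Function.update_self]
  rw [integral_prod_mul (fun ω => b t ω) (fun z : ℝ => z)]
  rw [integral_id_gaussianReal, mul_zero]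

theorem IsPredictable.integrable_sq {b : ℕ → A.Sample → ℝ} (hb : A.IsPredictable b) {B : ℝ}
    (hB : ∀ t ω, |b t ω| ≤ B) (t : ℕ) : Integrable (fun ω => b t ω ^ 2) A.law := by
  refine Integrable.of_bound ((hb.measurable t).pow_const 2).aestronglyMeasurable (B ^ 2)
    (Filter.Eventually.of_forall fun ω => ?_)
  rw [norm_pow]
  exact pow_le_pow_left₀ (norm_nonneg _) (hB t ω) 2

theorem IsPredictable.integrable_logTilt {b : ℕ → A.Sample → ℝ} (hb : A.IsPredictable b) {B : ℝ}
    (hB : ∀ t ω, |b t ω| ≤ B) (n : ℕ) : Integrable (A.logTilt b n) A.law :=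
  integrable_finsetSum _ fun s _ =>
    (hb.integrable_mul_noise hB s).sub ((hb.integrable_sq hB s).div_const 2)

theorem IsPredictable.integral_logTilt {b : ℕ → A.Sample → ℝ} (hb : A.IsPredictable b) {B : ℝ}
    (hB : ∀ t ω, |b t ω| ≤ B) (n : ℕ) :
    ∫ ω, A.logTilt b n ω ∂A.law = - (∫ ω, ∑ s ∈ Finset.range n, b s ω ^ 2 ∂A.law) / 2 := by
  have hi : ∀ s, Integrable (fun ω => b s ω * ω.2 s - b s ω ^ 2 / 2) A.law := fun s =>
    (hb.integrable_mul_noise hB s).sub ((hb.integrable_sq hB s).div_const 2)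
  simp only [logTilt]
  rw [integral_finsetSum _ fun s _ => hi s,
    integral_finsetSum _ fun s _ => hb.integrable_sq hB s, ← Finset.sum_neg_distrib,
    Finset.sum_div]
  refine Finset.sum_congr rfl fun s _ => ?_
  rw [integral_sub (hb.integrable_mul_noise hB s) ((hb.integrable_sq hB s).div_const 2),
    hb.integral_mul_noise, integral_div]
  ring

/-! ### Change of measure between two reward vectors -/

variable (A)

/-- The difference of the mean rewards of round `t` under `θ'` and under `θ`. -/
noncomputable def gap (θ θ' : Vec d) (t : ℕ) (ω : A.Sample) : ℝ :=
  inner ℝ (A.pulled θ t ω) (θ' - θ)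

/-- The gap of round `t` if there is a round `t`, and zero after stopping. -/
noncomputable def stoppedGap (θ θ' : Vec d) (t : ℕ) : A.Sample → ℝ :=
  (A.running θ t).indicator (A.gap θ θ' t)

theorem isPredictable_gap (θ θ' : Vec d) : A.IsPredictable (A.gap θ θ') where
  measurable t := (A.measurable_pulled θ t).inner measurable_const
  update hst ω z := by simp only [gap, A.pulled_update θ ω hst]

theorem isPredictable_stoppedGap (θ θ' : Vec d) : A.IsPredictable (A.stoppedGap θ θ') where
  measurable t := ((A.isPredictable_gap θ θ').measurable t).indicator (A.measurableSet_running θ t)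
  update {s t} hst ω z := by
    have h := A.mem_running_update θ ω hst z
    by_cases hω : ω ∈ A.running θ s
    · rw [stoppedGap, Set.indicator_of_mem hω, Set.indicator_of_mem (h.2 hω),
        (A.isPredictable_gap θ θ').update hst]
    · rw [stoppedGap, Set.indicator_of_notMem hω, Set.indicator_of_notMem (mt h.1 hω)]

/-- Reweighting by the likelihood ratio turns the law of the history under `θ` into that
under `θ'`. -/
theorem lintegral_history_eq (θ θ' : Vec d) (t : ℕ) {g : A.Seed × (Fin t → ℝ) → ℝ≥0∞}
    (hg : Measurable g) :
    ∫⁻ ω, g (ω.1, A.rewards θ' ω t) ∂A.law =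
      ∫⁻ ω, g (ω.1, A.rewards θ ω t) * ENNReal.ofReal (Real.exp (A.logTilt (A.gap θ θ') t ω))
        ∂A.law := by
  induction t with
  | zero => simp [logTilt, rewards]
  | succ t ih =>
    have hb := A.isPredictable_gap θ θ'
    have hmG : ∀ ψ : Vec d, Measurable fun ω => g (ω.1, A.rewards ψ ω (t + 1)) := fun ψ =>
      hg.comp (measurable_fst.prodMk (A.measurable_rewards ψ (t + 1)))
    have hsn : Measurable fun q : (A.Seed × (Fin t → ℝ)) × ℝ =>
        g (q.1.1, Fin.snoc (α := fun _ => ℝ) q.1.2 q.2) :=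
      hg.comp ((measurable_fst.comp measurable_fst).prodMk
        (measurable_snoc (measurable_snd.comp measurable_fst) measurable_snd))
    rw [A.lintegral_resample t (hmG θ')]
    simp only [rewards_succ, A.rewards_update _ _ le_rfl, Function.update_self]
    have hg' : Measurable fun p : A.Seed × (Fin t → ℝ) =>
        ∫⁻ z, g (p.1, Fin.snoc (α := fun _ => ℝ) p.2 (inner ℝ (A.arm t p.1 p.2) θ' + z))
          ∂gaussianReal 0 1 := by
      refine Measurable.lintegral_prod_right' (f := fun q : (A.Seed × (Fin t → ℝ)) × ℝ =>
        g (q.1.1, Fin.snoc (α := fun _ => ℝ) q.1.2 (inner ℝ (A.arm t q.1.1 q.1.2) θ' + q.2))) ?_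
      refine hsn.comp (measurable_fst.prodMk (Measurable.add ?_ measurable_snd))
      exact ((A.arm_measurable t).comp measurable_fst).inner measurable_const
    have hmL : Measurable fun ω => g (ω.1, A.rewards θ ω (t + 1)) *
        ENNReal.ofReal (Real.exp (A.logTilt (A.gap θ θ') (t + 1) ω)) :=
      (hmG θ).mul (hb.measurable_logTilt (t + 1)).exp.ennreal_ofReal
    have hre := A.lintegral_resample t hmL
    simp only [rewards_succ] at hre
    rw [ih hg', hre]
    refine lintegral_congr fun ω => ?_
    simp only [A.rewards_update _ _ le_rfl, Function.update_self,
      logTilt_succ, hb.logTilt_update le_rfl, hb.update le_rfl, Real.exp_add]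
    simp_rw [ENNReal.ofReal_mul (Real.exp_nonneg _)]
    set y := A.rewards θ ω t
    set m : ℝ := inner ℝ (A.arm t ω.1 y) θ
    have hm' : inner ℝ (A.arm t ω.1 y) θ' = m + A.gap θ θ' t ω := by
      simp only [gap, pulled, inner_sub_right, m, y]; ring
    have hf : Measurable fun z : ℝ => g (ω.1, Fin.snoc (α := fun _ => ℝ) y (m + z)) :=
      hsn.comp ((measurable_const (a := (ω.1, y))).prodMk (measurable_const_add m))
    have key := lintegral_gaussianReal_shift _ hf (A.gap θ θ' t ω)
    simp only [← add_assoc] at key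
    rw [hm', key, mul_comm, ← lintegral_const_mul' _ _ ENNReal.ofReal_ne_top]
    refine lintegral_congr fun z => ?_
    ring

/-! ### The transportation inequality -/

/-- The event that the algorithm stops at time `t` and recommends an arm in `S`. -/
def stopAt (θ : Vec d) (S : Set (Vec d)) (t : ℕ) : Set A.Sample :=
  {ω | (ω.1, A.rewards θ ω t) ∈ A.firstHalt t ∧ A.recommend t ω.1 (A.rewards θ ω t) ∈ S}

/-- The event that the algorithm stops and recommends an arm in `S`. -/
def stopIn (θ : Vec d) (S : Set (Vec d)) : Set A.Sample := ⋃ t, A.stopAt θ S t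

theorem measurableSet_stopAt (θ : Vec d) {S : Set (Vec d)} (hS : MeasurableSet S) (t : ℕ) :
    MeasurableSet (A.stopAt θ S t) := by
  have h := measurable_fst.prodMk (A.measurable_rewards θ t)
  exact (h (A.measurableSet_firstHalt t)).inter ((A.recommend_measurable t).comp h hS)

theorem measurableSet_stopIn (θ : Vec d) {S : Set (Vec d)} (hS : MeasurableSet S) :
    MeasurableSet (A.stopIn θ S) :=
  MeasurableSet.iUnion fun t => A.measurableSet_stopAt θ hS t

theorem pairwise_disjoint_stopAt (θ : Vec d) (S S' : Set (Vec d)) {s t : ℕ} (hst : s ≠ t) :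
    Disjoint (A.stopAt θ S s) (A.stopAt θ S' t) := by
  refine Set.disjoint_left.2 fun ω h1 h2 => hst ?_
  have e1 := (A.numSamples_eq_coe_iff θ ω s).2 h1.1
  have e2 := (A.numSamples_eq_coe_iff θ ω t).2 h2.1
  rw [e1] at e2
  exact_mod_cast e2

/-- Rounds after stopping do not contribute to the likelihood ratio of events that are determined
by the stopped history. -/
theorem law_stopAt_eq (θ θ' : Vec d) {S : Set (Vec d)} (hS : MeasurableSet S) {t n : ℕ}
    (htn : t < n) :
    A.law (A.stopAt θ' S t) = ∫⁻ ω in A.stopAt θ S t,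
      ENNReal.ofReal (Real.exp (A.logTilt (A.stoppedGap θ θ') n ω)) ∂A.law := by
  classical
  let E : Set (A.Seed × (Fin t → ℝ)) := A.firstHalt t ∩ (fun p => A.recommend t p.1 p.2) ⁻¹' S
  have hE : MeasurableSet E := (A.measurableSet_firstHalt t).inter (A.recommend_measurable t hS)
  have h := A.lintegral_history_eq θ θ' t (g := E.indicator 1) (measurable_one.indicator hE)
  have hind : ∀ (ψ : Vec d) (ω : A.Sample), E.indicator (1 : A.Seed × (Fin t → ℝ) → ℝ≥0∞)
      (ω.1, A.rewards ψ ω t) = (A.stopAt ψ S t).indicator 1 ω := fun _ _ => rfl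
  simp only [hind] at h
  rw [lintegral_indicator_one (A.measurableSet_stopAt θ' hS t)] at h
  rw [h, ← lintegral_indicator (A.measurableSet_stopAt θ hS t)]
  refine lintegral_congr fun ω => ?_
  by_cases hω : ω ∈ A.stopAt θ S t
  · rw [Set.indicator_of_mem hω, Set.indicator_of_mem hω, Pi.one_apply, one_mul]
    have hτ := (A.numSamples_eq_coe_iff θ ω t).2 hω.1
    have hlt : ∀ s, ω ∈ A.running θ s ↔ s < t := fun s => by
      rw [mem_running_iff_lt, hτ]; exact Nat.cast_lt
    have hs1 : ∀ s, s < t → A.stoppedGap θ θ' s ω = A.gap θ θ' s ω := fun s hs =>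
      Set.indicator_of_mem ((hlt s).2 hs) _
    have hs2 : ∀ s, ¬ s < t → A.stoppedGap θ θ' s ω = 0 := fun s hs =>
      Set.indicator_of_notMem (mt (hlt s).1 hs) _
    congr 2
    unfold logTilt
    symm
    rw [← Finset.sum_subset (Finset.range_mono htn.le)]
    · exact Finset.sum_congr rfl fun s hs => by rw [hs1 s (Finset.mem_range.1 hs)]
    · intro s _ hs
      rw [hs2 s (by simpa using hs)]; simp
  · rw [Set.indicator_of_notMem hω, Set.indicator_of_notMem hω, zero_mul]

theorem law_biUnion_stopAt_eq (θ θ' : Vec d) {S : Set (Vec d)} (hS : MeasurableSet S) (n : ℕ) :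
    A.law (⋃ t ∈ Finset.range n, A.stopAt θ' S t) = ∫⁻ ω in ⋃ t ∈ Finset.range n, A.stopAt θ S t,
      ENNReal.ofReal (Real.exp (A.logTilt (A.stoppedGap θ θ') n ω)) ∂A.law := by
  rw [measure_biUnion_finset (fun s _ t _ hst => A.pairwise_disjoint_stopAt θ' S S hst)
      (fun t _ => A.measurableSet_stopAt θ' hS t),
    lintegral_biUnion_finset (fun s _ t _ hst => A.pairwise_disjoint_stopAt θ S S hst)
      (fun t _ => A.measurableSet_stopAt θ hS t)]
  exact Finset.sum_congr rfl fun t ht => A.law_stopAt_eq θ θ' hS (Finset.mem_range.1 ht)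

/-- The transportation inequality for the event `E` of stopping before time `n`. It is the
Donsker–Varadhan bound on the Kullback–Leibler divergence between the laws of the stopped histories,
with the test function `a 1_E`, and with `log x` relaxed to `x - 1`. -/
theorem transport_truncated {R : ℝ} (hX : ∀ x ∈ X, ‖x‖ ≤ R) (θ θ' : Vec d) {S : Set (Vec d)}
    (hS : MeasurableSet S) (a : ℝ) (n : ℕ) :
    a * A.law.real (⋃ t ∈ Finset.range n, A.stopAt θ S t) ≤
      (Real.exp a - 1) * A.law.real (⋃ t ∈ Finset.range n, A.stopAt θ' S t)
        + (∫ ω, ∑ s ∈ Finset.range n, A.stoppedGap θ θ' s ω ^ 2 ∂A.law) / 2 := by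
  set E := ⋃ t ∈ Finset.range n, A.stopAt θ S t with hEdef
  have hE : MeasurableSet E := Finset.measurableSet_biUnion _
    fun t _ => A.measurableSet_stopAt θ hS t
  have hb := A.isPredictable_stoppedGap θ θ'
  have hB : ∀ t ω, |A.stoppedGap θ θ' t ω| ≤ R * ‖θ' - θ‖ := fun t ω => by
    have h0 : 0 ≤ R := (norm_nonneg _).trans (hX _ (A.pulled_mem θ t ω))
    by_cases hω : ω ∈ A.running θ t
    · rw [stoppedGap, Set.indicator_of_mem hω]
      exact (abs_real_inner_le_norm _ _).trans
        (mul_le_mul_of_nonneg_right (hX _ (A.pulled_mem θ t ω)) (norm_nonneg _))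
    · rw [stoppedGap, Set.indicator_of_notMem hω, abs_zero]
      positivity
  set L := A.logTilt (A.stoppedGap θ θ') n
  have hL : Integrable L A.law := hb.integrable_logTilt hB n
  have hLm : Measurable L := hb.measurable_logTilt n
  have hexp1 := hb.lintegral_exp_logTilt n
  have hexpI : Integrable (fun ω => Real.exp (L ω)) A.law :=
    (lintegral_ofReal_ne_top_iff_integrable (hLm.exp).aestronglyMeasurable
      (Filter.Eventually.of_forall fun _ => Real.exp_nonneg _)).1 (by rw [hexp1]; simp)
  have hI1 : ∫ ω, Real.exp (L ω) ∂A.law = 1 := by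
    rw [integral_eq_lintegral_of_nonneg_ae (Filter.Eventually.of_forall fun _ => Real.exp_nonneg _)
      (hLm.exp).aestronglyMeasurable, hexp1, ENNReal.toReal_one]
  have hI2 : ∫ ω, E.indicator (fun ω => Real.exp (L ω)) ω ∂A.law
      = A.law.real (⋃ t ∈ Finset.range n, A.stopAt θ' S t) := by
    rw [integral_indicator hE, integral_eq_lintegral_of_nonneg_ae
      (Filter.Eventually.of_forall fun _ => Real.exp_nonneg _) (hLm.exp).aestronglyMeasurable,
      Measure.real, A.law_biUnion_stopAt_eq θ θ' hS n]
  have hI3 : ∫ ω, E.indicator (fun _ => a) ω ∂A.law = a * A.law.real E := by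
    rw [integral_indicator_const _ hE, smul_eq_mul, mul_comm]
  have hi3 : Integrable (E.indicator fun _ => a) A.law := (integrable_const a).indicator hE
  have hi2 := (hexpI.indicator hE).const_mul (Real.exp a - 1)
  -- `u + 1 ≤ exp u` at `u = a 1_E + L`, with `exp (a 1_E) = 1 + (exp a - 1) 1_E`
  have hpt : ∀ ω, E.indicator (fun _ => a) ω + L ω ≤
      (Real.exp a - 1) * E.indicator (fun ω => Real.exp (L ω)) ω + Real.exp (L ω) - 1 := by
    intro ω
    have h := Real.add_one_le_exp (E.indicator (fun _ => a) ω + L ω)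
    by_cases hω : ω ∈ E
    · simp only [Set.indicator_of_mem hω, Real.exp_add] at h ⊢
      linarith
    · simp only [Set.indicator_of_notMem hω, zero_add] at h ⊢
      linarith
  have hi4 : Integrable (fun ω => (Real.exp a - 1) * E.indicator (fun ω => Real.exp (L ω)) ω
      + Real.exp (L ω)) A.law := hi2.add hexpI
  have hint := integral_mono (hi3.add hL) (hi4.sub (integrable_const 1)) hpt
  simp only [Pi.add_apply, Pi.sub_apply] at hint
  rw [integral_add hi3 hL, integral_sub hi4 (integrable_const 1),
    integral_add hi2 hexpI, integral_const_mul, hI1, hI2, hI3,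
    hb.integral_logTilt hB n, integral_const, probReal_univ, one_smul] at hint
  linarith

/-- For a stopped algorithm, an event that is likely under `θ` and unlikely under `θ'` is paid
for by the expected squared mean difference of the rewards that were observed under `θ`. -/
theorem transport {R : ℝ} (hX : ∀ x ∈ X, ‖x‖ ≤ R) (θ θ' : Vec d) {S : Set (Vec d)}
    (hS : MeasurableSet S) {a : ℝ} (ha : 0 ≤ a) :
    ENNReal.ofReal a * A.law (A.stopIn θ S) ≤
      ENNReal.ofReal (Real.exp a - 1) * A.law (A.stopIn θ' S)
        + ENNReal.ofReal (1 / 2) *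
          ∫⁻ ω, ∑' t, ENNReal.ofReal (A.stoppedGap θ θ' t ω ^ 2) ∂A.law := by
  have hunion : ∀ ψ, A.stopIn ψ S = ⋃ n, ⋃ t ∈ Finset.range n, A.stopAt ψ S t := fun ψ => by
    ext ω
    simp only [stopIn, Set.mem_iUnion, Finset.mem_range]
    exact ⟨fun ⟨t, h⟩ => ⟨t + 1, t, t.lt_succ_self, h⟩, fun ⟨_, t, _, h⟩ => ⟨t, h⟩⟩
  have hmono : ∀ ψ, Monotone fun n => ⋃ t ∈ Finset.range n, A.stopAt ψ S t := fun ψ m n hmn =>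
    Set.biUnion_subset_biUnion_left fun t ht =>
      Finset.mem_range.2 ((Finset.mem_range.1 ht).trans_le hmn)
  rw [hunion θ, (hmono θ).measure_iUnion, ENNReal.mul_iSup]
  refine iSup_le fun n => ?_
  have hb := A.isPredictable_stoppedGap θ θ'
  have hea : 0 ≤ Real.exp a - 1 := by linarith [Real.add_one_le_exp a]
  have hsq : ∫ ω, ∑ s ∈ Finset.range n, A.stoppedGap θ θ' s ω ^ 2 ∂A.law =
      (∫⁻ ω, ENNReal.ofReal (∑ s ∈ Finset.range n, A.stoppedGap θ θ' s ω ^ 2) ∂A.law).toReal := by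
    refine integral_eq_lintegral_of_nonneg_ae
      (Filter.Eventually.of_forall fun _ => Finset.sum_nonneg fun _ _ => sq_nonneg _) ?_
    exact (Finset.measurable_fun_sum _ fun s _ =>
      (hb.measurable s).pow_const 2).aestronglyMeasurable
  have h0 := ENNReal.ofReal_le_ofReal (A.transport_truncated hX θ θ' hS a n)
  rw [ENNReal.ofReal_mul ha, ENNReal.ofReal_add (mul_nonneg hea measureReal_nonneg) (by
      refine div_nonneg (integral_nonneg fun _ => Finset.sum_nonneg fun _ _ => sq_nonneg _) ?_
      norm_num), ENNReal.ofReal_mul hea, ofReal_measureReal (measure_ne_top _ _),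
    ofReal_measureReal (measure_ne_top _ _),
    div_eq_inv_mul, ENNReal.ofReal_mul (by norm_num), hsq, ← one_div] at h0
  refine h0.trans ?_
  gcongr
  · exact Set.iUnion₂_subset fun t _ => Set.subset_iUnion (A.stopAt θ' S) t
  · refine ENNReal.ofReal_toReal_le.trans (lintegral_mono fun ω => ?_)
    rw [ENNReal.ofReal_sum_of_nonneg fun _ _ => sq_nonneg _]
    exact ENNReal.sum_le_tsum _

end Algorithm

namespace Algorithm

variable {d : ℕ} {X : Set (Vec d)} (A : Algorithm X)

/-- The transportation inequality summed over finitely many alternatives `θ' j`: their total cost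
per observed sample is at most `K`. -/
theorem sum_transport {R : ℝ} (hX : ∀ x ∈ X, ‖x‖ ≤ R) {ι : Type*} [Fintype ι] (θ : Vec d)
    (θ' : ι → Vec d) {S : ι → Set (Vec d)} (hS : ∀ j, MeasurableSet (S j)) {a K : ℝ} (ha : 0 ≤ a)
    (hK : ∀ x ∈ X, ∑ j, (inner ℝ x (θ' j - θ) : ℝ) ^ 2 ≤ K) (hfin : A.expectedSamples θ ≠ ⊤) :
    a * ∑ j, A.law.real (A.stopIn θ (S j)) ≤
      (Real.exp a - 1) * ∑ j, A.law.real (A.stopIn (θ' j) (S j))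
        + K / 2 * (A.expectedSamples θ).toReal := by
  have hK0 : 0 ≤ K := by
    obtain ⟨ω⟩ : Nonempty A.Sample := A.law.nonempty_of_neZero
    exact (Finset.sum_nonneg fun _ _ => sq_nonneg _).trans (hK _ (A.pulled_mem θ 0 ω))
  have hea : 0 ≤ Real.exp a - 1 := by linarith [Real.add_one_le_exp a]
  have hcost : ∑ j, ∫⁻ ω, ∑' t, ENNReal.ofReal (A.stoppedGap θ (θ' j) t ω ^ 2) ∂A.law ≤
      ENNReal.ofReal K * A.expectedSamples θ := by
    rw [← lintegral_finsetSum _ fun j _ => Measurable.tsum fun t =>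
      (((A.isPredictable_stoppedGap θ (θ' j)).measurable t).pow_const 2).ennreal_ofReal,
      expectedSamples, ← lintegral_const_mul' _ _ ENNReal.ofReal_ne_top]
    refine lintegral_mono fun ω => ?_
    rw [← Summable.tsum_finsetSum fun _ _ => ENNReal.summable]
    refine le_trans ?_ (mul_le_mul_right (A.tsum_running_le θ ω) _)
    rw [← ENNReal.tsum_mul_left]
    refine ENNReal.tsum_le_tsum fun t => ?_
    by_cases hω : ω ∈ A.running θ t
    · simp only [stoppedGap, Set.indicator_of_mem hω, mul_one]
      rw [← ENNReal.ofReal_sum_of_nonneg fun _ _ => sq_nonneg _]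
      exact ENNReal.ofReal_le_ofReal (hK _ (A.pulled_mem θ t ω))
    · simp [stoppedGap, Set.indicator_of_notMem hω]
  have hsum := Finset.sum_le_sum fun j (_ : j ∈ Finset.univ) => A.transport hX θ (θ' j) (hS j) ha
  rw [Finset.sum_add_distrib, ← Finset.mul_sum, ← Finset.mul_sum, ← Finset.mul_sum] at hsum
  have hle := hsum.trans (add_le_add_right (mul_le_mul_right hcost (ENNReal.ofReal (1 / 2))) _)
  have hreal : ∀ (ψ : ι → Vec d), ENNReal.ofReal (∑ j, A.law.real (A.stopIn (ψ j) (S j)))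
      = ∑ j, A.law (A.stopIn (ψ j) (S j)) := fun ψ => by
    rw [ENNReal.ofReal_sum_of_nonneg fun _ _ => measureReal_nonneg]
    exact Finset.sum_congr rfl fun j _ => ofReal_measureReal (measure_ne_top _ _)
  have hnn : ∀ (ψ : ι → Vec d), 0 ≤ ∑ j, A.law.real (A.stopIn (ψ j) (S j)) := fun ψ =>
    Finset.sum_nonneg fun _ _ => measureReal_nonneg
  have hr := hreal fun _ => θ
  rw [← hr, ← hreal θ', ← ENNReal.ofReal_toReal hfin, ← ENNReal.ofReal_mul ha,
    ← ENNReal.ofReal_mul hea, ← ENNReal.ofReal_mul hK0, ← ENNReal.ofReal_mul (by norm_num),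
    ← ENNReal.ofReal_add (mul_nonneg hea (hnn θ')) (by positivity),
    ENNReal.ofReal_le_ofReal_iff (add_nonneg (mul_nonneg hea (hnn θ')) (by positivity))] at hle
  linarith

/-! ### Recommendations of a correct algorithm -/

theorem mem_stopIn_iff {θ : Vec d} {S S' : Set (Vec d)} {t : ℕ} {ω : A.Sample}
    (h : ω ∈ A.stopAt θ S t) :
    ω ∈ A.stopIn θ S' ↔ A.recommend t ω.1 (A.rewards θ ω t) ∈ S' := by
  constructor
  · intro h'
    obtain ⟨s, hs⟩ := Set.mem_iUnion.1 h'
    have hst : s = t := by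
      by_contra hne
      exact Set.disjoint_left.1 (A.pairwise_disjoint_stopAt θ S' S hne) hs h
    subst hst
    exact hs.2
  · exact fun h' => Set.mem_iUnion.2 ⟨t, h.1, h'⟩

theorem stopIn_union (θ : Vec d) (S S' : Set (Vec d)) :
    A.stopIn θ (S ∪ S') = A.stopIn θ S ∪ A.stopIn θ S' := by
  simp only [stopIn, ← Set.iUnion_union_distrib]
  refine Set.iUnion_congr fun t => ?_
  ext ω
  simp only [stopAt, Set.mem_union, Set.mem_ofPred_eq]
  tauto

theorem stopIn_mono (θ : Vec d) {S S' : Set (Vec d)} (h : S ⊆ S') :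
    A.stopIn θ S ⊆ A.stopIn θ S' :=
  Set.iUnion_mono fun _ _ hω => ⟨hω.1, h hω.2⟩

theorem real_stopIn_le_add (θ : Vec d) {S S₁ S₂ : Set (Vec d)} (h : S ⊆ S₁ ∪ S₂) :
    A.law.real (A.stopIn θ S) ≤ A.law.real (A.stopIn θ S₁) + A.law.real (A.stopIn θ S₂) := by
  refine (measureReal_mono (A.stopIn_mono θ h)).trans ?_
  rw [stopIn_union]
  exact measureReal_union_le _ _

theorem disjoint_stopIn_compl (θ : Vec d) (S : Set (Vec d)) :
    Disjoint (A.stopIn θ S) (A.stopIn θ Sᶜ) := by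
  refine Set.disjoint_left.2 fun ω h1 h2 => ?_
  obtain ⟨t, ht⟩ := Set.mem_iUnion.1 h1
  exact (A.mem_stopIn_iff ht).1 h2 ht.2

variable {A}

theorem IsPAC.le_real_stopIn {ε δ : ℝ} (hA : A.IsPAC ε δ) {θ : Vec d} {S : Set (Vec d)}
    (h : ∀ y ∈ X, (∀ x ∈ X, inner ℝ (x - y) θ ≤ ε) → y ∈ S) :
    1 - δ ≤ A.law.real (A.stopIn θ S) := by
  have hsub : A.successEvent θ ε ⊆ A.stopIn θ S := by
    rintro ω ⟨t, ht, hx⟩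
    exact Set.mem_iUnion.2
      ⟨t, (A.numSamples_eq_coe_iff θ ω t).1 ht, h _ (A.recommend_mem _ _ _) hx⟩
  have h1 := (hA θ).trans (measure_mono hsub)
  rwa [← ofReal_measureReal (measure_ne_top _ _), ENNReal.ofReal_le_ofReal_iff measureReal_nonneg]
    at h1

theorem IsPAC.real_stopIn_compl_le {ε δ : ℝ} (hA : A.IsPAC ε δ) {θ : Vec d} {S : Set (Vec d)}
    (hS : MeasurableSet S) (h : ∀ y ∈ X, (∀ x ∈ X, inner ℝ (x - y) θ ≤ ε) → y ∈ S) :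
    A.law.real (A.stopIn θ Sᶜ) ≤ δ := by
  have h1 := hA.le_real_stopIn h
  have h2 := measureReal_union (μ := A.law) (A.disjoint_stopIn_compl θ S)
    (A.measurableSet_stopIn θ hS.compl)
  have h3 : A.law.real (A.stopIn θ S ∪ A.stopIn θ Sᶜ) ≤ 1 := measureReal_le_one
  linarith

end Algorithm

/-! ### Sign vectors -/

/-- The vector all of whose coordinates are `Δ` or `-Δ`, according to the signs `s`
(`true` for `+`). -/
noncomputable def signVec {d : ℕ} (Δ : ℝ) (s : Fin d → Bool) : Vec d :=
  WithLp.toLp 2 fun i => if s i then Δ else -Δ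

/-- The number of coordinates in which the sign of `x` is not the one prescribed by `s`. -/
noncomputable def signErrors {d : ℕ} (x : Vec d) (s : Fin d → Bool) : ℕ :=
  (Finset.univ.filter fun i => decide (0 < x i) ≠ s i).card

/-- The sign pattern `s` with the sign of coordinate `i` reversed. -/
def flipSign {d : ℕ} (i : Fin d) (s : Fin d → Bool) : Fin d → Bool :=
  Function.update s i (!s i)

variable {d : ℕ}

theorem signVec_apply (Δ : ℝ) (s : Fin d → Bool) (i : Fin d) :
    signVec Δ s i = if s i then Δ else -Δ := rfl

theorem flipSign_involutive (i : Fin d) : Function.Involutive (flipSign i) := fun s => by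
  simp [flipSign]

theorem inner_signVec (Δ : ℝ) (s : Fin d → Bool) (x : Vec d) :
    inner ℝ x (signVec Δ s) = ∑ i, x i * (if s i then Δ else -Δ) := by
  simp only [PiLp.inner_apply, signVec_apply, RCLike.inner_apply, conj_trivial]
  exact Finset.sum_congr rfl fun i _ => mul_comm _ _

theorem sum_sign_mul_sign {i j : Fin d} (hij : i ≠ j) (Δ : ℝ) :
    ∑ s : Fin d → Bool, (if s i then Δ else -Δ) * (if s j then Δ else -Δ) = 0 := by
  have h := (flipSign_involutive i).bijective.sum_comp
    fun s : Fin d → Bool => (if s i then Δ else -Δ) * (if s j then Δ else -Δ)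
  have h2 : ∀ s : Fin d → Bool, (if flipSign i s i then Δ else -Δ) *
      (if flipSign i s j then Δ else -Δ)
      = -((if s i then Δ else -Δ) * (if s j then Δ else -Δ)) := fun s => by
    have e1 : flipSign i s i = !s i := by simp [flipSign]
    have e2 : flipSign i s j = s j := by simp [flipSign, hij.symm]
    rw [e1, e2]
    cases s i <;> cases s j <;> simp
  rw [Finset.sum_congr rfl fun s _ => h2 s, Finset.sum_neg_distrib] at h
  linarith

theorem sum_inner_signVec_sq (Δ : ℝ) (x : Vec d) :
    ∑ s : Fin d → Bool, (inner ℝ x (signVec Δ s) : ℝ) ^ 2 = 2 ^ d * (Δ * ‖x‖) ^ 2 := by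
  simp only [inner_signVec, sq (Finset.sum _ _), Finset.sum_mul_sum]
  rw [Finset.sum_comm]
  have h : ∀ i, ∑ s : Fin d → Bool, ∑ j, x i * (if s i then Δ else -Δ) *
      (x j * (if s j then Δ else -Δ)) = 2 ^ d * (Δ ^ 2 * x i ^ 2) := fun i => by
    rw [Finset.sum_comm, Finset.sum_eq_single i]
    · have : ∀ s : Fin d → Bool, x i * (if s i then Δ else -Δ) * (x i * (if s i then Δ else -Δ))
          = Δ ^ 2 * x i ^ 2 := fun s => by split_ifs <;> ring
      rw [Finset.sum_congr rfl fun s _ => this s]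
      simp
    · intro j _ hji
      have : ∀ s : Fin d → Bool, x i * (if s i then Δ else -Δ) * (x j * (if s j then Δ else -Δ))
          = x i * x j * ((if s i then Δ else -Δ) * (if s j then Δ else -Δ)) := fun s => by ring
      rw [Finset.sum_congr rfl fun s _ => this s, ← Finset.mul_sum,
        sum_sign_mul_sign hji.symm, mul_zero]
    · simp
  rw [Finset.sum_congr rfl fun i _ => h i, ← Finset.mul_sum, ← Finset.mul_sum, mul_pow,
    EuclideanSpace.real_norm_sq_eq]

theorem inner_signVec_flipSign_sub (Δ : ℝ) (s : Fin d → Bool) (i : Fin d) (x : Vec d) :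
    (inner ℝ x (signVec Δ (flipSign i s) - signVec Δ s) : ℝ) ^ 2 = 4 * Δ ^ 2 * x i ^ 2 := by
  rw [inner_sub_right, inner_signVec, inner_signVec, ← Finset.sum_sub_distrib,
    Finset.sum_eq_single i]
  · simp only [flipSign, Function.update_self]
    cases s i <;> simp <;> ring
  · intro j _ hji
    simp [flipSign, Function.update_of_ne hji]
  · simp

theorem signErrors_add_signErrors_not (x : Vec d) (s : Fin d → Bool) :
    signErrors x s + signErrors x (fun i => !s i) = d := by
  have h := Finset.card_filter_add_card_filter_not (s := (Finset.univ : Finset (Fin d)))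
    (fun i => decide (0 < x i) ≠ s i)
  rw [Finset.card_univ, Fintype.card_fin] at h
  unfold signErrors
  convert h using 3
  ext i
  cases s i <;> cases decide (0 < x i) <;> simp

theorem measurableSet_sign_eq (i : Fin d) (b : Bool) :
    MeasurableSet {x : Vec d | decide (0 < x i) = b} := by
  have h : MeasurableSet {x : Vec d | 0 < x i} :=
    measurableSet_lt measurable_const (by fun_prop)
  cases b
  · simpa [Set.compl_ofPred] using h.compl
  · simpa using h

theorem measurableSet_signErrors_le (s : Fin d → Bool) :
    MeasurableSet {x : Vec d | 8 * signErrors x s ≤ d} := by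
  have h : Measurable fun x : Vec d => signErrors x s := by
    simp only [signErrors, Finset.card_filter]
    refine Finset.measurable_fun_sum _ fun i _ => ?_
    exact Measurable.ite (measurableSet_sign_eq i (s i)).compl measurable_const measurable_const
  exact measurableSet_le (measurable_const.mul h) measurable_const

variable {d : ℕ}

/-! ### Lower bounds from sign-vector rewards -/

/-- The reward vectors with coordinates `±Δ` are a hard family for `X`: an `ε`-best arm reveals
all but an eighth of the signs, while the observations carry little information, since
`(Δ R) ^ 2` bounds the squared mean reward of an arm for a random sign vector, on average. -/
structure IsSignHard (X : Set (Vec d)) (R Δ ε : ℝ) : Prop where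
  norm_le : ∀ x ∈ X, ‖x‖ ≤ R
  signErrors_le : ∀ (s : Fin d → Bool), ∀ y ∈ X,
    (∀ x ∈ X, inner ℝ (x - y) (signVec Δ s) ≤ ε) → 8 * signErrors y s ≤ d
  information_le : (Δ * R) ^ 2 * d ≤ 256 * ε ^ 2

namespace IsSignHard

variable {X : Set (Vec d)} {R Δ ε δ : ℝ} {A : Algorithm X}

theorem sq_mul_norm_le (h : IsSignHard X R Δ ε) {x : Vec d} (hx : x ∈ X) :
    (Δ * ‖x‖) ^ 2 ≤ (Δ * R) ^ 2 := by
  rw [mul_pow, mul_pow]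
  have := pow_le_pow_left₀ (norm_nonneg x) (h.norm_le x hx) 2
  gcongr

/-- Without any signal, the recommendation cannot be right for both a sign vector and its
negative, but by correctness it is right for each with probability at least `1 - δ` when that
vector is the reward vector. Averaged over the signs, a sample carries information `(Δ R)² / 2`
only. -/
theorem confidence_le (h : IsSignHard X R Δ ε) (hd : 1 ≤ d) (hδ : 0 < δ) (hδ' : δ < 1 / 16)
    (hA : A.IsPAC ε δ) (hfin : A.expectedSamples 0 ≠ ⊤) :
    d * Real.log (1 / δ) ≤ 1280 * ε ^ 2 * (A.expectedSamples 0).toReal := by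
  set L := Real.log (1 / δ) with hL
  have hexpL : Real.exp L = 1 / δ := Real.exp_log (by positivity)
  -- by `δ < 1/16`, the gain `L / 2 - 1` below is of order `L`
  have hL83 : 8 / 3 ≤ L := by
    have h1 : Real.log 16 ≤ L := Real.log_le_log (by norm_num) (by
      rw [le_div_iff₀ hδ]; linarith)
    have h2 : Real.log 16 = 4 * Real.log 2 := by
      rw [show (16 : ℝ) = 2 ^ 4 by norm_num, Real.log_pow]; norm_num
    have := Real.log_two_gt_d9
    linarith
  let good : (Fin d → Bool) → Set (Vec d) := fun s => {x | 8 * signErrors x s ≤ d}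
  have hgood : ∀ s, MeasurableSet (good s) := measurableSet_signErrors_le
  have hneg : Function.Involutive fun (s : Fin d → Bool) i => !s i := fun s => by simp
  have hK : ∀ x ∈ X, ∑ s : Fin d → Bool, (inner ℝ x (signVec Δ s - 0) : ℝ) ^ 2
      ≤ 2 ^ d * (Δ * R) ^ 2 := fun x hx => by
    simp only [sub_zero, sum_inner_signVec_sq]
    exact mul_le_mul_of_nonneg_left (h.sq_mul_norm_le hx) (by positivity)
  -- with `a = log (1/δ)`, the events of probability at most `δ` contribute at most `1` each
  have key := A.sum_transport h.norm_le 0 (signVec Δ) (fun s => (hgood s).compl)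
    (by linarith : 0 ≤ L) hK hfin
  have hright : ∑ s, A.law.real (A.stopIn (signVec Δ s) (good s)ᶜ) ≤ 2 ^ d * δ := by
    calc _ ≤ ∑ _s : Fin d → Bool, δ := Finset.sum_le_sum fun s _ =>
          hA.real_stopIn_compl_le (hgood s) (h.signErrors_le s)
      _ = 2 ^ d * δ := by simp
  have hleft : 2 ^ d * (1 - δ) ≤ 2 * ∑ s, A.law.real (A.stopIn 0 (good s)ᶜ) := by
    have e := hneg.bijective.sum_comp fun s => A.law.real (A.stopIn 0 (good s)ᶜ)
    calc (2 : ℝ) ^ d * (1 - δ) = ∑ _s : Fin d → Bool, (1 - δ) := by simp [mul_sub]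
      _ ≤ ∑ s, (A.law.real (A.stopIn 0 (good s)ᶜ)
            + A.law.real (A.stopIn 0 (good fun i => !s i)ᶜ)) := by
          refine Finset.sum_le_sum fun s _ => ?_
          refine (hA.le_real_stopIn (S := Set.univ) fun _ _ _ => Set.mem_univ _).trans
            (A.real_stopIn_le_add 0 fun x _ => ?_)
          have := signErrors_add_signErrors_not x s
          by_contra hx
          simp only [Set.mem_union, Set.mem_compl_iff, not_or, not_not, good,
            Set.mem_ofPred_eq] at hx
          omega
      _ = _ := by rw [Finset.sum_add_distrib, e, two_mul]
  have h2 : (0 : ℝ) < 2 ^ d := by positivity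
  set T := (A.expectedSamples 0).toReal with hT
  have hT0 : 0 ≤ T := ENNReal.toReal_nonneg
  have hstep : L * (1 - δ) ≤ 2 * (1 - δ) + (Δ * R) ^ 2 * T := by
    have h3 : (Real.exp L - 1) * ∑ s, A.law.real (A.stopIn (signVec Δ s) (good s)ᶜ)
        ≤ 2 ^ d * (1 - δ) := by
      rw [hexpL]
      calc _ ≤ (1 / δ - 1) * (2 ^ d * δ) := mul_le_mul_of_nonneg_left hright (by
            rw [sub_nonneg, le_div_iff₀ hδ]; linarith)
        _ = _ := by field_simp
    have h4 := mul_le_mul_of_nonneg_left hleft (by linarith : 0 ≤ L)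
    refine le_of_mul_le_mul_left ?_ h2
    linarith
  have hinfo := mul_le_mul_of_nonneg_right h.information_le hT0
  have h5 : 15 / 64 * L ≤ (Δ * R) ^ 2 * T := by nlinarith
  have h6 := mul_le_mul_of_nonneg_left h5 (Nat.cast_nonneg (α := ℝ) d)
  nlinarith

/-- Under the reward vector with signs `s`, a correct algorithm makes few sign errors. -/
theorem sum_real_sign_ne_le (h : IsSignHard X R Δ ε) (hA : A.IsPAC ε δ) (s : Fin d → Bool) :
    ∑ i, A.law.real (A.stopIn (signVec Δ s) {x | decide (0 < x i) = s i}ᶜ) ≤ d / 8 + d * δ := by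
  classical
  set θ : Vec d := signVec Δ s
  let bad : Fin d → Set (Vec d) := fun i => {x | decide (0 < x i) = s i}ᶜ
  have hbad : ∀ i, MeasurableSet (bad i) := fun i => (measurableSet_sign_eq i (s i)).compl
  let G : Set (Vec d) := {x | 8 * signErrors x s ≤ d}
  have hG : MeasurableSet G := measurableSet_signErrors_le s
  have hpt : ∀ ω, ∑ i, (A.stopIn θ (bad i)).indicator (fun _ => (1 : ℝ)) ω
      ≤ d / 8 + (A.stopIn θ Gᶜ).indicator (fun _ => (d : ℝ)) ω := by
    intro ω
    by_cases hω : ∃ t, ω ∈ A.stopAt θ Set.univ t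
    · obtain ⟨t, ht⟩ := hω
      set y := A.recommend t ω.1 (A.rewards θ ω t)
      have hsum : ∑ i, (A.stopIn θ (bad i)).indicator (fun _ => (1 : ℝ)) ω = signErrors y s := by
        rw [signErrors, Finset.card_filter, Nat.cast_sum]
        refine Finset.sum_congr rfl fun i _ => ?_
        have : ω ∈ A.stopIn θ (bad i) ↔ decide (0 < y i) ≠ s i := A.mem_stopIn_iff ht
        rw [Set.indicator_apply, Nat.cast_ite, Nat.cast_one, Nat.cast_zero]
        exact if_congr this rfl rfl
      rw [hsum]
      by_cases hy : 8 * signErrors y s ≤ d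
      · have h1 : 0 ≤ (A.stopIn θ Gᶜ).indicator (fun _ => (d : ℝ)) ω :=
          Set.indicator_nonneg (fun _ _ => Nat.cast_nonneg d) _
        have h2 : (8 : ℝ) * signErrors y s ≤ d := by exact_mod_cast hy
        linarith
      · have hmem : ω ∈ A.stopIn θ Gᶜ := (A.mem_stopIn_iff ht).2 hy
        rw [Set.indicator_of_mem hmem]
        have h1 : signErrors y s ≤ d := by
          have := signErrors_add_signErrors_not y s
          omega
        have h2 : (signErrors y s : ℝ) ≤ d := by exact_mod_cast h1
        have h3 : (0 : ℝ) ≤ d := Nat.cast_nonneg d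
        linarith
    · have hnot : ∀ S, ω ∉ A.stopIn θ S := fun S hS => hω (by
        obtain ⟨t, ht⟩ := Set.mem_iUnion.1 hS
        exact ⟨t, ht.1, Set.mem_univ _⟩)
      simp only [Set.indicator_of_notMem (hnot _), Finset.sum_const_zero, add_zero]
      positivity
  have hi : ∀ i, Integrable ((A.stopIn θ (bad i)).indicator fun _ => (1 : ℝ)) A.law := fun i =>
    (integrable_const _).indicator (A.measurableSet_stopIn θ (hbad i))
  have hGm := A.measurableSet_stopIn θ hG.compl
  have hiG : Integrable ((A.stopIn θ Gᶜ).indicator fun _ => (d : ℝ)) A.law :=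
    (integrable_const _).indicator hGm
  have hint := integral_mono (integrable_finsetSum _ fun i _ => hi i)
    ((integrable_const ((d : ℝ) / 8)).add hiG) hpt
  simp only [Pi.add_apply] at hint
  rw [integral_finsetSum _ fun i _ => hi i, integral_add (integrable_const _) hiG, integral_const,
    probReal_univ, one_smul, integral_indicator_const _ hGm, smul_eq_mul] at hint
  have hone : ∀ i, ∫ ω, (A.stopIn θ (bad i)).indicator (fun _ => (1 : ℝ)) ω ∂A.law
      = A.law.real (A.stopIn θ (bad i)) := fun i => by
    rw [integral_indicator_const _ (A.measurableSet_stopIn θ (hbad i)), smul_eq_mul, mul_one]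
  simp only [hone] at hint
  have hGδ := hA.real_stopIn_compl_le hG (h.signErrors_le s)
  have := mul_le_mul_of_nonneg_right hGδ (Nat.cast_nonneg (α := ℝ) d)
  linarith

/-- Reversing one sign changes the law of the history little unless many samples are taken, but
a correct algorithm recovers most of the signs; this is compared on average over all sign
vectors and coordinates. -/
theorem dimension_le (h : IsSignHard X R Δ ε) (hd : 1 ≤ d) (hδ' : δ < 1 / 16)
    (hA : A.IsPAC ε δ) (hfin : ∀ θ, A.expectedSamples θ ≠ ⊤) :
    ∃ θ, (d : ℝ) ^ 2 ≤ 1280 * ε ^ 2 * (A.expectedSamples θ).toReal := by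
  let E : (Fin d → Bool) → Fin d → Set (Vec d) := fun s i => {x | decide (0 < x i) = s i}
  have hE : ∀ s i, MeasurableSet (E s i) := fun s i => measurableSet_sign_eq i (s i)
  have hEflip : ∀ s i, E (flipSign i s) i = (E s i)ᶜ := fun s i => by
    ext x
    simp only [E, Set.mem_ofPred_eq, Set.mem_compl_iff, flipSign, Function.update_self]
    cases s i <;> cases decide (0 < x i) <;> simp
  let T : (Fin d → Bool) → ℝ := fun s => (A.expectedSamples (signVec Δ s)).toReal
  -- the sum over all `s` of the expected number of sign errors under `signVec Δ s`
  let M : ℝ := ∑ s, ∑ i, A.law.real (A.stopIn (signVec Δ s) (E s i)ᶜ)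
  have hdR : (0 : ℝ) < d := by exact_mod_cast hd
  have hM : M ≤ 2 ^ d * (3 / 16 * d) := by
    calc M ≤ ∑ _s : Fin d → Bool, ((d : ℝ) / 8 + d * δ) :=
          Finset.sum_le_sum fun s _ => h.sum_real_sign_ne_le hA s
      _ = 2 ^ d * ((d : ℝ) / 8 + d * δ) := by simp [mul_add]
      _ ≤ _ := by
          refine mul_le_mul_of_nonneg_left ?_ (by positivity)
          nlinarith
  have hright : ∑ s, ∑ i, A.law.real (A.stopIn (signVec Δ (flipSign i s)) (E s i)) = M := by
    rw [Finset.sum_comm, show M = ∑ i, ∑ s, _ from Finset.sum_comm]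
    refine Finset.sum_congr rfl fun i _ => ?_
    rw [← (flipSign_involutive i).bijective.sum_comp]
    refine Finset.sum_congr rfl fun s _ => ?_
    rw [flipSign_involutive i s, hEflip]
  have hleft : 2 ^ d * (15 / 16 * d) ≤
      ∑ s, ∑ i, A.law.real (A.stopIn (signVec Δ s) (E s i)) + M := by
    rw [show M = ∑ s, ∑ i, _ from rfl, ← Finset.sum_add_distrib]
    calc (2 : ℝ) ^ d * (15 / 16 * d) = ∑ _s : Fin d → Bool, ∑ _i : Fin d, (15 / 16 : ℝ) := by
          simp [mul_comm]
      _ ≤ _ := by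
          refine Finset.sum_le_sum fun s _ => ?_
          rw [← Finset.sum_add_distrib]
          refine Finset.sum_le_sum fun i _ => ?_
          have h1 := hA.le_real_stopIn (S := Set.univ) (θ := signVec Δ s)
            fun _ _ _ => Set.mem_univ _
          have h2 := A.real_stopIn_le_add (signVec Δ s) (S := Set.univ) (S₁ := E s i)
            (S₂ := (E s i)ᶜ) (by rw [Set.union_compl_self])
          linarith
  have hK : ∀ s, ∀ x ∈ X, ∑ i, (inner ℝ x (signVec Δ (flipSign i s) - signVec Δ s) : ℝ) ^ 2
      ≤ 4 * (Δ * R) ^ 2 := fun s x hx => by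
    simp only [inner_signVec_flipSign_sub]
    rw [← Finset.mul_sum, ← EuclideanSpace.real_norm_sq_eq]
    have := h.sq_mul_norm_le hx
    rw [mul_pow] at this
    linarith
  have key : ∑ s, ∑ i, A.law.real (A.stopIn (signVec Δ s) (E s i)) ≤
      (Real.exp 1 - 1) * M + 2 * (Δ * R) ^ 2 * ∑ s, T s := by
    rw [← hright, Finset.mul_sum, Finset.mul_sum, ← Finset.sum_add_distrib]
    refine Finset.sum_le_sum fun s _ => ?_
    have := A.sum_transport h.norm_le (signVec Δ s) (fun i => signVec Δ (flipSign i s))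
      (hE s) zero_le_one (hK s) (hfin _)
    simp only [T]
    linarith
  have hsum : 2 ^ d * (2 / 5 * (d : ℝ)) ≤ 2 * (Δ * R) ^ 2 * ∑ s, T s := by
    have he : Real.exp 1 < 2.72 := by have := Real.exp_one_lt_d9; linarith
    have hM0 : 0 ≤ M := Finset.sum_nonneg fun _ _ => Finset.sum_nonneg fun _ _ =>
      measureReal_nonneg
    have h1 : Real.exp 1 * M ≤ 2.72 * (2 ^ d * (3 / 16 * d)) := by
      calc _ ≤ 2.72 * M := mul_le_mul_of_nonneg_right he.le hM0
        _ ≤ _ := by linarith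
    have h2 : (0 : ℝ) < 2 ^ d * d := by positivity
    linarith
  obtain ⟨s, -, hs⟩ := Finset.exists_le_of_sum_le (s := (Finset.univ : Finset (Fin d → Bool)))
    (f := fun _ => 2 / 5 * (d : ℝ)) (g := fun s => 2 * (Δ * R) ^ 2 * T s)
    Finset.univ_nonempty
    (by rw [Finset.sum_const, nsmul_eq_mul, ← Finset.mul_sum]; simpa using hsum)
  refine ⟨signVec Δ s, ?_⟩
  have hT0 : 0 ≤ T s := ENNReal.toReal_nonneg
  have hinfo := mul_le_mul_of_nonneg_right h.information_le hT0
  have hstep := mul_le_mul_of_nonneg_right hs hdR.le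
  change (d : ℝ) ^ 2 ≤ 1280 * ε ^ 2 * T s
  linarith

theorem exists_le_expectedSamples (h : IsSignHard X R Δ ε) (hε : 0 < ε) (hd : 1 ≤ d) (hδ : 0 < δ)
    (hδ' : δ < 1 / 16) (hA : A.IsPAC ε δ) :
    ∃ θ, ENNReal.ofReal (1 / 2560 * (d * Real.log (1 / δ) / ε ^ 2 + d ^ 2 / ε ^ 2)) ≤
      A.expectedSamples θ := by
  by_cases hfin : ∀ θ, A.expectedSamples θ ≠ ⊤
  swap
  · obtain ⟨θ, hθ⟩ := not_forall_not.1 hfin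
    exact ⟨θ, hθ ▸ le_top⟩
  obtain ⟨θ, hθ⟩ := h.dimension_le hd hδ' hA hfin
  have h0 := h.confidence_le hd hδ hδ' hA (hfin 0)
  have hε2 : 0 < ε ^ 2 := by positivity
  rcases le_total (d * Real.log (1 / δ)) ((d : ℝ) ^ 2) with hle | hle
  · refine ⟨θ, ENNReal.ofReal_le_of_le_toReal ?_⟩
    rw [← add_div, mul_div_assoc', div_le_iff₀ hε2]
    linarith
  · refine ⟨0, ENNReal.ofReal_le_of_le_toReal ?_⟩
    rw [← add_div, mul_div_assoc', div_le_iff₀ hε2]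
    linarith

end IsSignHard

/-! ### The three arm sets -/

theorem signErrors_eq_sum (x : Vec d) (s : Fin d → Bool) :
    (signErrors x s : ℝ) = ∑ i, if decide (0 < x i) ≠ s i then (1 : ℝ) else 0 := by
  rw [signErrors, Finset.card_filter]
  push_cast
  rfl

theorem norm_le_sqrt_of_abs_le_one {x : Vec d} (h : ∀ i, |x i| ≤ 1) : ‖x‖ ≤ √d := by
  rw [EuclideanSpace.norm_eq]
  refine Real.sqrt_le_sqrt ?_
  calc ∑ i, ‖x i‖ ^ 2 ≤ ∑ _i : Fin d, (1 : ℝ) := Finset.sum_le_sum fun i _ => by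
        rw [Real.norm_eq_abs]
        exact pow_le_one₀ (abs_nonneg _) (h i)
    _ = d := by simp

theorem abs_le_one_of_mem_signCube {x : Vec d} (hx : x ∈ signCube d) (i : Fin d) : |x i| ≤ 1 := by
  rcases hx i with h | h <;> simp [h]

theorem abs_le_one_of_mem_binaryCube {x : Vec d} (hx : x ∈ binaryCube d) (i : Fin d) :
    |x i| ≤ 1 := by
  rcases hx i with h | h <;> simp [h]

theorem information_cube_le (hd : 1 ≤ d) (ε : ℝ) :
    (8 * ε / d * √d) ^ 2 * d ≤ 256 * ε ^ 2 := by
  have hdR : (0 : ℝ) < d := by exact_mod_cast hd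
  rw [mul_pow, Real.sq_sqrt hdR.le, div_pow]
  have : (8 * ε) ^ 2 / (d : ℝ) ^ 2 * d * d = 64 * ε ^ 2 := by field_simp; ring
  rw [this]
  nlinarith [sq_nonneg ε]

theorem eight_mul_le_of_regret {m : ℕ} (hd : 1 ≤ d) {ε : ℝ} (hε : 0 < ε)
    (h : 8 * ε / d * m ≤ ε) : 8 * m ≤ d := by
  have hdR : (0 : ℝ) < d := by exact_mod_cast hd
  have h1 : 8 * ε / d * m = ε * (8 * m / d) := by ring
  rw [h1] at h
  have h2 : 8 * (m : ℝ) / d ≤ 1 := by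
    by_contra hlt
    nlinarith
  rw [div_le_one hdR] at h2
  exact_mod_cast h2

theorem isSignHard_signCube (hd : 1 ≤ d) {ε : ℝ} (hε : 0 < ε) :
    IsSignHard (signCube d) (√d) (8 * ε / d) ε where
  norm_le x hx := norm_le_sqrt_of_abs_le_one (abs_le_one_of_mem_signCube hx)
  information_le := information_cube_le hd ε
  signErrors_le s y hy h := by
    have hdR : (0 : ℝ) < d := by exact_mod_cast hd
    have hmem : signVec 1 s ∈ signCube d := fun i => by
      rw [signVec_apply]; cases s i <;> simp
    refine eight_mul_le_of_regret hd hε (le_trans ?_ (h _ hmem))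
    rw [inner_signVec, signErrors_eq_sum, Finset.mul_sum]
    have hΔ : 0 ≤ 8 * ε / d := by positivity
    refine Finset.sum_le_sum fun i _ => ?_
    rw [PiLp.sub_apply, signVec_apply]
    rcases hy i with hi | hi <;> cases s i <;> norm_num [hi] <;> linarith

theorem isSignHard_binaryCube (hd : 1 ≤ d) {ε : ℝ} (hε : 0 < ε) :
    IsSignHard (binaryCube d) (√d) (8 * ε / d) ε where
  norm_le x hx := norm_le_sqrt_of_abs_le_one (abs_le_one_of_mem_binaryCube hx)
  information_le := information_cube_le hd ε
  signErrors_le s y hy h := by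
    have hdR : (0 : ℝ) < d := by exact_mod_cast hd
    let b : Vec d := WithLp.toLp 2 fun i => if s i then 1 else 0
    have hb : ∀ i, b i = if s i then 1 else 0 := fun _ => rfl
    have hmem : b ∈ binaryCube d := fun i => by
      rw [hb]; cases s i <;> simp
    refine eight_mul_le_of_regret hd hε (le_trans ?_ (h _ hmem))
    rw [inner_signVec, signErrors_eq_sum, Finset.mul_sum]
    have hΔ : 0 ≤ 8 * ε / d := by positivity
    refine Finset.sum_le_sum fun i _ => ?_
    rw [PiLp.sub_apply, hb]
    rcases hy i with hi | hi <;> cases s i <;> norm_num [hi]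

theorem isSignHard_unitBall (hd : 1 ≤ d) {ε : ℝ} (hε : 0 < ε) :
    IsSignHard (unitBall d) 1 (16 * ε / √d) ε where
  norm_le x hx := hx
  information_le := by
    have hdR : (0 : ℝ) < d := by exact_mod_cast hd
    rw [mul_one, div_pow, Real.sq_sqrt hdR.le]
    have : (16 * ε) ^ 2 / (d : ℝ) * d = 256 * ε ^ 2 := by field_simp; ring
    rw [this]
  signErrors_le s y hy h := by
    have hdR : (0 : ℝ) < d := by exact_mod_cast hd
    set r := √(d : ℝ) with hr
    have hr0 : 0 < r := Real.sqrt_pos.2 hdR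
    have hr2 : r ^ 2 = d := Real.sq_sqrt hdR.le
    have hmem : r⁻¹ • signVec 1 s ∈ unitBall d := by
      have h1 : ‖signVec 1 s‖ ≤ r := norm_le_sqrt_of_abs_le_one fun i => by
        rw [signVec_apply]; cases s i <;> simp
      change ‖_‖ ≤ 1
      rw [norm_smul, norm_inv, Real.norm_of_nonneg hr0.le, inv_mul_le_iff₀ hr0, mul_one]
      exact h1
    have hreg := h _ hmem
    have hscale : ∀ x : Vec d, (inner ℝ x (signVec (16 * ε / r) s) : ℝ)
        = 16 * ε / r * inner ℝ x (signVec 1 s) := fun x => by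
      rw [inner_signVec, inner_signVec, Finset.mul_sum]
      exact Finset.sum_congr rfl fun i _ => by cases s i <;> simp <;> ring
    have hself : (inner ℝ (signVec 1 s) (signVec 1 s) : ℝ) = d := by
      rw [inner_signVec]
      have : ∀ i, signVec 1 s i * (if s i then (1 : ℝ) else -1) = 1 := fun i => by
        rw [signVec_apply]; cases s i <;> simp
      simp [this]
    rw [hscale, inner_sub_left, inner_smul_left, hself, RCLike.conj_to_real, inner_signVec] at hreg
    set m : ℝ := (signErrors y s : ℝ) with hm
    -- only the coordinates with the right sign contribute, and there are `d - m` of them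
    set g : Fin d → ℝ := fun i => if decide (0 < y i) ≠ s i then 0 else 1
    have hg : ∑ i, g i = d - m := by
      rw [hm, signErrors_eq_sum, eq_sub_iff_add_eq, ← Finset.sum_add_distrib]
      have : ∀ i, g i + (if decide (0 < y i) ≠ s i then (1 : ℝ) else 0) = 1 := fun i => by
        simp only [g]; split_ifs <;> simp
      rw [Finset.sum_congr rfl fun i _ => this i]
      simp
    have hle : ∑ i, y i * (if s i then (1 : ℝ) else -1) ≤ ∑ i, g i * |y i| := by
      refine Finset.sum_le_sum fun i _ => ?_
      simp only [g]
      by_cases hy0 : 0 < y i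
      · cases s i <;> simp [hy0, abs_of_pos, hy0.le]
      · have := not_lt.1 hy0
        cases s i <;> simp [hy0, abs_of_nonpos, this]
    have hcs : (∑ i, g i * |y i|) ^ 2 ≤ d - m := by
      have h1 := Finset.sum_mul_sq_le_sq_mul_sq Finset.univ g fun i => |y i|
      have h2 : ∑ i, g i ^ 2 = d - m := by
        rw [← hg]
        exact Finset.sum_congr rfl fun i _ => by simp only [g]; split_ifs <;> simp
      have h3 : ∑ i, |y i| ^ 2 ≤ 1 := by
        simp only [sq_abs]
        rw [← EuclideanSpace.real_norm_sq_eq]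
        exact pow_le_one₀ (norm_nonneg _) hy
      have h4 : 0 ≤ (d : ℝ) - m := by
        rw [← h2]; exact Finset.sum_nonneg fun _ _ => sq_nonneg _
      rw [h2] at h1
      nlinarith
    set q := ∑ i, g i * |y i|
    have hreg2 : 16 * ε / r * (r - q) ≤ ε := by
      refine le_trans (mul_le_mul_of_nonneg_left ?_ (by positivity)) hreg
      have : r⁻¹ * (d : ℝ) = r := by rw [← hr2]; field_simp
      linarith
    have h16 : 16 * (r - q) ≤ r := by
      have : 16 * ε / r * (r - q) = ε * (16 * (r - q) / r) := by ring
      rw [this] at hreg2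
      have h2 : 16 * (r - q) / r ≤ 1 := by
        by_contra hlt
        nlinarith
      rwa [div_le_one hr0] at h2
    have hfin : 8 * m ≤ d := by nlinarith
    rw [hm] at hfin
    exact_mod_cast hfin

variable {d : ℕ}

/-! ### Concentration of a Gaussian vector -/

theorem lintegral_exp_sq_div_four_gaussianReal :
    ∫⁻ z, ENNReal.ofReal (Real.exp (z ^ 2 / 4)) ∂gaussianReal 0 1 = ENNReal.ofReal (√2) := by
  rw [gaussianReal_of_var_ne_zero _ one_ne_zero,
    lintegral_withDensity_eq_lintegral_mul _ (measurable_gaussianPDF _ _) (by fun_prop),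
    ← mul_one (ENNReal.ofReal √2), ← lintegral_gaussianPDF_eq_one 0 (v := 2) two_ne_zero,
    ← lintegral_const_mul' _ _ ENNReal.ofReal_ne_top]
  refine lintegral_congr fun z => ?_
  simp only [Pi.mul_apply, gaussianPDF, gaussianPDFReal]
  rw [← ENNReal.ofReal_mul (by positivity), ← ENNReal.ofReal_mul (by positivity), mul_assoc,
    ← Real.exp_add, ← mul_assoc]
  have h1 : (√(2 * Real.pi * (1 : NNReal)))⁻¹ = √2 * (√(2 * Real.pi * (2 : NNReal)))⁻¹ := by
    have : (2 * Real.pi * (2 : NNReal) : ℝ) = 2 * (2 * Real.pi * (1 : NNReal)) := by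
      push_cast; ring
    rw [this, Real.sqrt_mul (show (0 : ℝ) ≤ 2 by norm_num), mul_inv, ← mul_assoc,
      mul_inv_cancel₀ (by positivity), one_mul]
  have h2 : -(z - 0) ^ 2 / (2 * (1 : NNReal)) + z ^ 2 / 4 = -(z - 0) ^ 2 / (2 * (2 : NNReal)) := by
    push_cast; ring
  rw [h1, h2]

/-- The law of `d` independent standard Gaussian coordinates. -/
noncomputable abbrev coordGaussian (d : ℕ) : Measure (Fin d → ℝ) :=
  Measure.pi fun _ => gaussianReal 0 1

theorem lintegral_prod_coordGaussian {f : Fin d → ℝ → ℝ≥0∞} (hf : ∀ i, Measurable (f i)) :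
    ∫⁻ g, ∏ i, f i (g i) ∂coordGaussian d = ∏ i, ∫⁻ z, f i z ∂gaussianReal 0 1 := by
  rw [lintegral_prod_eq_prod_lintegral_of_indepFun Finset.univ (fun i (g : Fin d → ℝ) => f i (g i))
    (iIndepFun_pi fun i => (hf i).aemeasurable) fun i => (hf i).comp (measurable_pi_apply i)]
  exact Finset.prod_congr rfl fun i _ =>
    (measurePreserving_eval (fun _ : Fin d => gaussianReal 0 1) i).lintegral_comp (hf i)

theorem lintegral_exp_linear_coordGaussian (c : Fin d → ℝ) :
    ∫⁻ g, ENNReal.ofReal (Real.exp (∑ i, c i * g i)) ∂coordGaussian d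
      = ENNReal.ofReal (Real.exp (∑ i, c i ^ 2 / 2)) := by
  simp_rw [Real.exp_sum, ENNReal.ofReal_prod_of_nonneg fun _ _ => Real.exp_nonneg _]
  rw [lintegral_prod_coordGaussian (f := fun i z => ENNReal.ofReal (Real.exp (c i * z)))
    fun i => by fun_prop]
  refine Finset.prod_congr rfl fun i _ => ?_
  have h := lintegral_exp_gaussianReal_tilt (c i)
  have h2 : ∀ z, ENNReal.ofReal (Real.exp (c i * z)) = ENNReal.ofReal (Real.exp (c i ^ 2 / 2)) *
      ENNReal.ofReal (Real.exp (c i * z - c i ^ 2 / 2)) := fun z => by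
    rw [← ENNReal.ofReal_mul (Real.exp_nonneg _), ← Real.exp_add]
    congr 2; ring
  simp_rw [h2]
  rw [lintegral_const_mul' _ _ ENNReal.ofReal_ne_top, h, mul_one]

theorem lintegral_exp_norm_sq_coordGaussian :
    ∫⁻ g, ENNReal.ofReal (Real.exp (∑ i, g i ^ 2 / 4)) ∂coordGaussian d
      = ENNReal.ofReal (√2) ^ d := by
  simp_rw [Real.exp_sum, ENNReal.ofReal_prod_of_nonneg fun _ _ => Real.exp_nonneg _]
  rw [lintegral_prod_coordGaussian (f := fun _ z => ENNReal.ofReal (Real.exp (z ^ 2 / 4)))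
    fun i => by fun_prop, lintegral_exp_sq_div_four_gaussianReal]
  simp

namespace Algorithm

variable {X : Set (Vec d)} (A : Algorithm X)

/-- The noise of the weighted sum of the first `n` rewards with vector weights `w`. -/
noncomputable def weightedNoise (w : ℕ → Vec d) (n : ℕ) (ω : A.Sample) : Vec d :=
  ∑ t ∈ Finset.range n, ω.2 t • w t

theorem measurable_weightedNoise (w : ℕ → Vec d) (n : ℕ) : Measurable (A.weightedNoise w n) :=
  Finset.measurable_fun_sum _ fun t _ =>
    Measurable.smul_const (by fun_prop : Measurable fun ω : A.Sample => ω.2 t) _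

theorem lintegral_exp_linear_noise (c : ℕ → ℝ) (n : ℕ) :
    ∫⁻ ω, ENNReal.ofReal (Real.exp (∑ t ∈ Finset.range n, c t * ω.2 t)) ∂A.law
      = ENNReal.ofReal (Real.exp (∑ t ∈ Finset.range n, c t ^ 2 / 2)) := by
  have hb : A.IsPredictable fun t _ => c t := ⟨fun _ => measurable_const, fun _ _ _ => rfl⟩
  have h := hb.lintegral_exp_logTilt n
  have h2 : ∀ ω : A.Sample, ENNReal.ofReal (Real.exp (∑ t ∈ Finset.range n, c t * ω.2 t)) =
      ENNReal.ofReal (Real.exp (∑ t ∈ Finset.range n, c t ^ 2 / 2)) *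
      ENNReal.ofReal (Real.exp (A.logTilt (fun t _ => c t) n ω)) := fun ω => by
    rw [← ENNReal.ofReal_mul (Real.exp_nonneg _), ← Real.exp_add, logTilt,
      Finset.sum_sub_distrib]
    congr 2; ring
  simp_rw [h2]
  rw [lintegral_const_mul' _ _ ENNReal.ofReal_ne_top, h, mul_one]

/-- The exponential of a squared norm is a Gaussian average of exponentials of linear forms,
which are explicit for a linear image of the noise. -/
theorem lintegral_exp_norm_sq_weightedNoise_le {w : ℕ → Vec d} {n : ℕ} {v : ℝ} (hv : 0 < v)
    (hw : ∀ g : Vec d, ∑ t ∈ Finset.range n, (inner ℝ g (w t) : ℝ) ^ 2 ≤ v * ‖g‖ ^ 2) :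
    ∫⁻ ω, ENNReal.ofReal (Real.exp (‖A.weightedNoise w n ω‖ ^ 2 / (4 * v))) ∂A.law
      ≤ ENNReal.ofReal (√2) ^ d := by
  set μ := √(1 / (2 * v)) with hμ
  have hμ2 : μ ^ 2 = 1 / (2 * v) := Real.sq_sqrt (by positivity)
  have hZ : ∀ (g : Fin d → ℝ) (ω : A.Sample), ∑ i, μ * A.weightedNoise w n ω i * g i =
      ∑ t ∈ Finset.range n, μ * inner ℝ (WithLp.toLp 2 g : Vec d) (w t) * ω.2 t := fun g ω => by
    have h1 : ∑ i, μ * A.weightedNoise w n ω i * g i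
        = μ * inner ℝ (WithLp.toLp 2 g : Vec d) (A.weightedNoise w n ω) := by
      simp only [PiLp.inner_apply, RCLike.inner_apply, conj_trivial, Finset.mul_sum, mul_assoc]
    rw [h1, weightedNoise, inner_sum, Finset.mul_sum]
    refine Finset.sum_congr rfl fun t _ => ?_
    rw [inner_smul_right]; ring
  calc ∫⁻ ω, ENNReal.ofReal (Real.exp (‖A.weightedNoise w n ω‖ ^ 2 / (4 * v))) ∂A.law
      = ∫⁻ ω, ∫⁻ g, ENNReal.ofReal (Real.exp (∑ i, μ * A.weightedNoise w n ω i * g i))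
          ∂coordGaussian d ∂A.law := by
        refine lintegral_congr fun ω => ?_
        rw [lintegral_exp_linear_coordGaussian, EuclideanSpace.real_norm_sq_eq, Finset.sum_div]
        congr 3
        ext i
        rw [mul_pow, hμ2]
        field_simp
        norm_num
    _ = ∫⁻ g, ∫⁻ ω, ENNReal.ofReal (Real.exp (∑ i, μ * A.weightedNoise w n ω i * g i))
          ∂A.law ∂coordGaussian d := by
        refine lintegral_lintegral_swap (Measurable.aemeasurable ?_)
        refine (Measurable.exp ?_).ennreal_ofReal
        refine Finset.measurable_fun_sum _ fun i _ => ?_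
        have h1 : Measurable fun p : A.Sample × (Fin d → ℝ) => A.weightedNoise w n p.1 i :=
          (by fun_prop : Measurable fun x : Vec d => x i).comp
            ((A.measurable_weightedNoise w n).comp measurable_fst)
        exact (h1.const_mul μ).mul (by fun_prop)
    _ ≤ ∫⁻ g, ENNReal.ofReal (Real.exp (∑ i, g i ^ 2 / 4)) ∂coordGaussian d := by
        refine lintegral_mono fun g => ?_
        simp_rw [hZ]
        rw [A.lintegral_exp_linear_noise]
        refine ENNReal.ofReal_le_ofReal (Real.exp_le_exp.2 ?_)
        have h1 := hw (WithLp.toLp 2 g)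
        rw [EuclideanSpace.real_norm_sq_eq] at h1
        simp only [mul_pow, hμ2]
        rw [← Finset.sum_div, ← Finset.mul_sum, ← Finset.sum_div]
        calc _ ≤ 1 / (2 * v) * (v * ∑ i, g i ^ 2) / 2 := by gcongr
          _ = _ := by field_simp; ring
    _ = _ := lintegral_exp_norm_sq_coordGaussian

/-- Chernoff's bound: the squared norm of a centred Gaussian vector with variance at most `v` in
each direction reaches `4 v (d + log (1/δ))` with probability at most `δ`. -/
theorem law_norm_weightedNoise_le {w : ℕ → Vec d} {n : ℕ} {v r δ : ℝ} (hv : 0 < v)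
    (hw : ∀ g : Vec d, ∑ t ∈ Finset.range n, (inner ℝ g (w t) : ℝ) ^ 2 ≤ v * ‖g‖ ^ 2)
    (hδ : 0 < δ) (hr : 4 * v * (d + Real.log (1 / δ)) ≤ r ^ 2) (hr0 : 0 ≤ r) :
    A.law {ω | r ≤ ‖A.weightedNoise w n ω‖} ≤ ENNReal.ofReal δ := by
  set K := ENNReal.ofReal (Real.exp (d + Real.log (1 / δ))) with hK
  have hK0 : K ≠ 0 := (ENNReal.ofReal_pos.2 (Real.exp_pos _)).ne'
  have hm : Measurable fun ω =>
      ENNReal.ofReal (Real.exp (‖A.weightedNoise w n ω‖ ^ 2 / (4 * v))) :=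
    (((A.measurable_weightedNoise w n).norm.pow_const 2).div_const _).exp.ennreal_ofReal
  have hmarkov := mul_meas_ge_le_lintegral (μ := A.law) hm K
  have hsub : {ω | r ≤ ‖A.weightedNoise w n ω‖} ⊆
      {ω | K ≤ ENNReal.ofReal (Real.exp (‖A.weightedNoise w n ω‖ ^ 2 / (4 * v)))} := by
    intro ω hω
    refine ENNReal.ofReal_le_ofReal (Real.exp_le_exp.2 ?_)
    rw [le_div_iff₀ (by positivity), mul_comm]
    exact hr.trans (pow_le_pow_left₀ hr0 hω 2)
  have h1 : K * A.law {ω | r ≤ ‖A.weightedNoise w n ω‖} ≤ ENNReal.ofReal (√2) ^ d :=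
    (mul_le_mul_right (measure_mono hsub) K).trans
      (hmarkov.trans (A.lintegral_exp_norm_sq_weightedNoise_le hv hw))
  have h2 : ENNReal.ofReal (√2) ^ d ≤ K * ENNReal.ofReal δ := by
    rw [hK, ← ENNReal.ofReal_mul (Real.exp_nonneg _), Real.exp_add, Real.exp_log (by positivity),
      mul_assoc, one_div, inv_mul_cancel₀ hδ.ne', mul_one, ← ENNReal.ofReal_pow (by positivity),
      ← mul_one (d : ℝ), Real.exp_nat_mul]
    refine ENNReal.ofReal_le_ofReal (pow_le_pow_left₀ (by positivity) ?_ d)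
    have h3 : √2 ≤ 2 := Real.sqrt_le_iff.2 (by norm_num)
    linarith [Real.add_one_le_exp 1]
  exact (ENNReal.mul_le_mul_iff_right hK0 ENNReal.ofReal_ne_top).1 (h1.trans h2)

end Algorithm

/-! ### Fixed designs with a linear estimator -/

/-- The algorithm that pulls the arms `x 0, …, x (T - 1)`, estimates the reward vector by
`∑ t, y t • w t`, and recommends the arm that `r` assigns to the estimate. -/
noncomputable def fixedDesign {X : Set (Vec d)} (x w : ℕ → Vec d) (hx : ∀ t, x t ∈ X)
    (r : Vec d → Vec d) (hr : Measurable r) (hrX : ∀ v, r v ∈ X) (T : ℕ) : Algorithm X where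
  Seed := Unit
  seedLaw := Measure.dirac ()
  arm t _ _ := x t
  arm_measurable _ := measurable_const
  arm_mem t _ _ := hx t
  halt t := {_p | t = T}
  halt_measurable _ := MeasurableSet.const _
  recommend _ _ y := r (∑ i, y i • w i)
  recommend_measurable _ := hr.comp (Finset.measurable_fun_sum _ fun i _ =>
    Measurable.smul_const ((measurable_pi_apply i).comp measurable_snd) _)
  recommend_mem _ _ _ := hrX _

/-- `r` selects a best arm of `X` for each reward vector. -/
structure IsBestArm (X : Set (Vec d)) (r : Vec d → Vec d) : Prop where
  measurable : Measurable r
  mem : ∀ v, r v ∈ X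
  inner_le : ∀ v, ∀ x ∈ X, inner ℝ (x - r v) v ≤ 0

section FixedDesign

variable {X : Set (Vec d)} {x w : ℕ → Vec d} (hx : ∀ t, x t ∈ X) {r : Vec d → Vec d}
  (hr : IsBestArm X r) (T : ℕ)

theorem isFixedDesign_fixedDesign :
    (fixedDesign x w hx r hr.measurable hr.mem T).IsFixedDesign T :=
  ⟨⟨x, fun _ _ _ => rfl⟩, fun _ _ _ => Iff.rfl⟩

theorem rewards_fixedDesign (θ : Vec d) (ω) (t : ℕ) (i : Fin t) :
    (fixedDesign x w hx r hr.measurable hr.mem T).rewards θ ω t i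
      = inner ℝ (x i) θ + ω.2 i := by
  induction t with
  | zero => exact i.elim0
  | succ t ih =>
    rw [Algorithm.rewards_succ]
    refine Fin.lastCases ?_ (fun j => ?_) i
    · rw [Fin.snoc_last]; rfl
    · rw [Fin.snoc_castSucc, ih]; rfl

theorem numSamples_fixedDesign (θ : Vec d) (ω) :
    (fixedDesign x w hx r hr.measurable hr.mem T).numSamples θ ω = T := by
  rw [Algorithm.numSamples_eq_coe_iff, Algorithm.mem_firstHalt]
  exact ⟨rfl, fun j hj h => hj.ne h⟩

theorem isPAC_fixedDesign {R v ε δ : ℝ} (hX : ∀ y ∈ X, ‖y‖ ≤ R) (hR : 0 < R) (hv : 0 < v)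
    (hε : 0 < ε) (hδ : 0 < δ)
    (hest : ∀ θ : Vec d, ∑ t ∈ Finset.range T, (inner ℝ (x t) θ : ℝ) • w t = θ)
    (hvar : ∀ g : Vec d, ∑ t ∈ Finset.range T, (inner ℝ g (w t) : ℝ) ^ 2 ≤ v * ‖g‖ ^ 2)
    (hT : 16 * R ^ 2 * v * (d + Real.log (1 / δ)) ≤ ε ^ 2) :
    (fixedDesign x w hx r hr.measurable hr.mem T).IsPAC ε δ := by
  intro θ
  set A := fixedDesign x w hx r hr.measurable hr.mem T
  set Z := A.weightedNoise w T with hZ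
  have hbad : A.law {ω | ε / (2 * R) ≤ ‖Z ω‖} ≤ ENNReal.ofReal δ := by
    refine A.law_norm_weightedNoise_le hv hvar hδ ?_ (by positivity)
    rw [div_pow, le_div_iff₀ (by positivity)]
    linarith
  have hmeas : MeasurableSet {ω | ε / (2 * R) ≤ ‖Z ω‖} :=
    measurableSet_le measurable_const (A.measurable_weightedNoise w T).norm
  have hsub : {ω | ε / (2 * R) ≤ ‖Z ω‖}ᶜ ⊆ A.successEvent θ ε := by
    intro ω hω
    have hω' : ‖Z ω‖ < ε / (2 * R) := not_le.1 hω
    refine ⟨T, numSamples_fixedDesign hx hr T θ ω, fun y hy => ?_⟩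
    have hrec : A.recommend T ω.1 (A.rewards θ ω T) = r (θ + Z ω) := by
      change r (∑ i : Fin T, A.rewards θ ω T i • w i) = _
      congr 1
      have h1 : ∀ i : Fin T, A.rewards θ ω T i • w i
          = (inner ℝ (x i) θ : ℝ) • w i + ω.2 i • w i := fun i => by
        rw [← add_smul]
        exact congrArg (· • w i) (rewards_fixedDesign hx hr T θ ω T i)
      rw [Finset.sum_congr rfl fun i _ => h1 i, Finset.sum_add_distrib,
        ← Finset.sum_range fun t => (inner ℝ (x t) θ : ℝ) • w t,
        ← Finset.sum_range fun t => ω.2 t • w t, hest]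
      rfl
    rw [hrec]
    set b := r (θ + Z ω)
    have h1 := hr.inner_le (θ + Z ω) y hy
    rw [inner_add_right] at h1
    have h2 : |(inner ℝ (y - b) (Z ω) : ℝ)| ≤ (2 * R) * ‖Z ω‖ :=
      (abs_real_inner_le_norm _ _).trans (mul_le_mul_of_nonneg_right
        ((norm_sub_le _ _).trans (by linarith [hX y hy, hX b (hr.mem _)])) (norm_nonneg _))
    have h3 : (2 * R) * ‖Z ω‖ ≤ ε := by
      rw [lt_div_iff₀ (by positivity)] at hω'
      linarith
    have h4 := (abs_le.1 h2).1
    change inner ℝ (y - b) θ ≤ ε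
    change (inner ℝ (y - b) θ : ℝ) + inner ℝ (y - b) (Z ω) ≤ 0 at h1
    linarith
  refine le_trans ?_ (measure_mono hsub)
  rw [prob_compl_eq_one_sub hmeas, ENNReal.ofReal_sub _ hδ.le, ENNReal.ofReal_one]
  exact tsub_le_tsub_left hbad 1

end FixedDesign

/-- A finite list of arms `x` of `X` with weights `w` for which `∑ j, ⟨x j, θ⟩ • w j` recovers
`θ`, and the estimator has variance at most `v` in every direction. -/
structure IsLinearDesign (X : Set (Vec d)) {J : Type} [Fintype J] (x w : J → Vec d) (v : ℝ) :
    Prop where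
  mem : ∀ j, x j ∈ X
  estimate : ∀ θ : Vec d, ∑ j, (inner ℝ (x j) θ : ℝ) • w j = θ
  variance_le : ∀ g : Vec d, ∑ j, (inner ℝ g (w j) : ℝ) ^ 2 ≤ v * ‖g‖ ^ 2

/-- A short design is repeated until its estimator is accurate enough. Since the regret of the
recommendation is at most `2 R` times the Euclidean norm of the estimation error, an error of
`ε / (2 R)` suffices. -/
theorem exists_fixedDesign_isPAC {X : Set (Vec d)} {R v : ℝ} (hd : 1 ≤ d) (hX : ∀ y ∈ X, ‖y‖ ≤ R)
    (hR : 0 < R) (hv : 0 < v) {r : Vec d → Vec d} (hr : IsBestArm X r) {J : Type} [Fintype J]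
    [Nonempty J] {x w : J → Vec d} (hJ : IsLinearDesign X x w v)
    (hcard : (Fintype.card J : ℝ) ≤ 4 * d) (hcost : R ^ 2 * v * Fintype.card J ≤ 4 * d)
    {ε δ : ℝ} (hε : 0 < ε) (hε1 : ε ≤ 1) (hδ : 0 < δ) (hδ1 : δ < 1) :
    ∃ (A : Algorithm X) (T : ℕ), A.IsFixedDesign T ∧ A.IsPAC ε δ ∧
      (T : ℝ) ≤ 68 * (d * Real.log (1 / δ) / ε ^ 2 + (d : ℝ) ^ 2 / ε ^ 2) := by
  classical
  have hL : 0 < Real.log (1 / δ) := Real.log_pos (by rw [lt_div_iff₀ hδ]; linarith)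
  set L := Real.log (1 / δ)
  have hdR : (1 : ℝ) ≤ d := by exact_mod_cast hd
  set q := 16 * R ^ 2 * v * (d + L) / ε ^ 2 with hq
  have hq0 : 0 < q := by positivity
  set m := ⌈q⌉₊ with hm
  have hm0 : 0 < m := Nat.ceil_pos.2 hq0
  have hmR : (0 : ℝ) < m := by exact_mod_cast hm0
  set T := Fintype.card (Fin m × J) with hT
  let e : Fin T ≃ Fin m × J := (Fintype.equivFin _).symm
  let j₀ : J := Classical.arbitrary J
  let x' : ℕ → Vec d := fun t => if h : t < T then x (e ⟨t, h⟩).2 else x j₀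
  let w' : ℕ → Vec d := fun t => if h : t < T then (m : ℝ)⁻¹ • w (e ⟨t, h⟩).2 else 0
  have hx'i : ∀ i : Fin T, x' i = x (e i).2 := fun i => dif_pos i.2
  have hw'i : ∀ i : Fin T, w' i = (m : ℝ)⁻¹ • w (e i).2 := fun i => dif_pos i.2
  have hx' : ∀ t, x' t ∈ X := fun t => by
    by_cases h : t < T
    · rw [show x' t = _ from dif_pos h]; exact hJ.mem _
    · rw [show x' t = _ from dif_neg h]; exact hJ.mem _
  refine ⟨fixedDesign x' w' hx' r hr.measurable hr.mem T, T, isFixedDesign_fixedDesign hx' hr T,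
    isPAC_fixedDesign hx' hr T hX hR (div_pos hv hmR) hε hδ ?_ ?_ ?_, ?_⟩
  · intro θ
    rw [Finset.sum_range]
    simp only [hx'i, hw'i]
    rw [e.sum_comp fun p : Fin m × J => (inner ℝ (x p.2) θ : ℝ) • (m : ℝ)⁻¹ • w p.2,
      Fintype.sum_prod_type]
    simp only [smul_comm _ (m : ℝ)⁻¹, ← Finset.smul_sum, hJ.estimate]
    rw [Finset.sum_const, Finset.card_univ, Fintype.card_fin, ← Nat.cast_smul_eq_nsmul ℝ,
      inv_smul_smul₀ hmR.ne']
  · intro g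
    rw [Finset.sum_range]
    simp only [hw'i]
    rw [e.sum_comp fun p : Fin m × J => (inner ℝ g ((m : ℝ)⁻¹ • w p.2) : ℝ) ^ 2,
      Fintype.sum_prod_type]
    simp only [inner_smul_right, mul_pow, ← Finset.mul_sum]
    rw [Finset.sum_const, Finset.card_univ, Fintype.card_fin, nsmul_eq_mul]
    calc (m : ℝ)⁻¹ ^ 2 * ((m : ℝ) * ∑ j, (inner ℝ g (w j) : ℝ) ^ 2)
        ≤ (m : ℝ)⁻¹ ^ 2 * ((m : ℝ) * (v * ‖g‖ ^ 2)) := by gcongr; exact hJ.variance_le g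
      _ = v / m * ‖g‖ ^ 2 := by field_simp
  · have h1 : q ≤ m := Nat.le_ceil q
    rw [hq, div_le_iff₀ (by positivity)] at h1
    have h2 : 16 * R ^ 2 * (v / m) * (d + L) = 16 * R ^ 2 * v * (d + L) / m := by ring
    rw [h2, div_le_iff₀ hmR]
    linarith
  · have h1 : (m : ℝ) ≤ q + 1 := (Nat.ceil_lt_add_one hq0.le).le
    have h2 : (T : ℝ) = m * Fintype.card J := by
      rw [hT, Fintype.card_prod, Fintype.card_fin, Nat.cast_mul]
    have h3 : q * Fintype.card J ≤ 64 * (d * (d + L) / ε ^ 2) := by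
      have : q * Fintype.card J = 16 * ((R ^ 2 * v * Fintype.card J) * ((d + L) / ε ^ 2)) := by
        rw [hq]; ring
      rw [this]
      calc _ ≤ 16 * ((4 * d) * ((d + L) / ε ^ 2)) := by gcongr
        _ = _ := by ring
    have h4 : (d : ℝ) ≤ d * (d + L) / ε ^ 2 := by
      rw [le_div_iff₀ (by positivity)]
      have : ε ^ 2 ≤ 1 := pow_le_one₀ hε.le hε1
      exact mul_le_mul_of_nonneg_left (by linarith) (by linarith)
    calc (T : ℝ) ≤ (q + 1) * Fintype.card J := by rw [h2]; gcongr
      _ ≤ 68 * (d * (d + L) / ε ^ 2) := by linarith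
      _ = _ := by ring

/-! ### Orthogonal sign designs -/

/-- The first `d` columns of a Sylvester–Hadamard matrix of order at most `2 d`,
indexed by sets `S` and `U` with the entry `(-1) ^ #(S ∩ U)`. -/
theorem exists_orthogonal_signs (hd : 1 ≤ d) :
    ∃ (J : Type) (_ : Fintype J) (_ : Nonempty J) (h : J → Vec d),
      (∀ j, h j ∈ signCube d) ∧ (Fintype.card J : ℝ) ≤ 2 * d ∧
      ∀ θ : Vec d, ∑ j, (inner ℝ (h j) θ : ℝ) • h j = (Fintype.card J : ℝ) • θ := by
  classical
  obtain ⟨k, hk1, hk2⟩ : ∃ k : ℕ, d ≤ 2 ^ k ∧ 2 ^ k ≤ 2 * d := by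
    refine ⟨Nat.log 2 d + 1, (Nat.lt_pow_succ_log_self one_lt_two d).le, ?_⟩
    rw [pow_succ, mul_comm]
    exact Nat.mul_le_mul_left 2 (Nat.pow_log_le_self 2 (by omega))
  obtain ⟨f⟩ : Nonempty (Fin d ↪ Finset (Fin k)) :=
    Function.Embedding.nonempty_of_card_le (by simpa using hk1)
  let χ : Finset (Fin k) → Fin k → ℝ := fun U a => if a ∈ U then -1 else 1
  have hχ : ∀ U a, χ U a = -1 ∨ χ U a = 1 := fun U a => by
    simp only [χ]; split_ifs <;> simp
  let h : Finset (Fin k) → Vec d := fun S => WithLp.toLp 2 fun i => ∏ a ∈ S, χ (f i) a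
  have hh : ∀ S i, h S i = ∏ a ∈ S, χ (f i) a := fun _ _ => rfl
  have horth : ∀ i j, ∑ S, h S i * h S j = if i = j then (2 : ℝ) ^ k else 0 := fun i j => by
    simp only [hh, ← Finset.prod_mul_distrib]
    have h1 := Finset.prod_one_add (f := fun a => χ (f i) a * χ (f j) a)
      (Finset.univ : Finset (Fin k))
    rw [Finset.powerset_univ] at h1
    rw [← h1]
    split_ifs with hij
    · subst hij
      have : ∀ a, 1 + χ (f i) a * χ (f i) a = 2 := fun a => by
        rcases hχ (f i) a with e | e <;> rw [e] <;> norm_num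
      simp [this]
    · have hne : f i ≠ f j := fun e => hij (f.injective e)
      obtain ⟨a, ha⟩ : ∃ a, ¬ (a ∈ f i ↔ a ∈ f j) := by
        by_contra hcon
        push Not at hcon
        exact hne (Finset.ext hcon)
      refine Finset.prod_eq_zero (Finset.mem_univ a) ?_
      simp only [χ]
      by_cases h1 : a ∈ f i <;> by_cases h2 : a ∈ f j <;> simp [h1, h2] at ha ⊢
  refine ⟨Finset (Fin k), inferInstance, inferInstance, h, fun S i => ?_, ?_, fun θ => ?_⟩
  · rw [hh]
    induction S using Finset.induction_on with
    | empty => simp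
    | insert a S ha ih =>
      rw [Finset.prod_insert ha]
      rcases ih with e | e <;> rcases hχ (f i) a with e' | e' <;> rw [e, e'] <;> norm_num
  · rw [Fintype.card_finset, Fintype.card_fin]
    exact_mod_cast hk2
  · ext j
    simp only [WithLp.ofLp_sum, Finset.sum_apply, PiLp.smul_apply, smul_eq_mul, PiLp.inner_apply,
      RCLike.inner_apply, conj_trivial, Finset.sum_mul]
    rw [Finset.sum_comm]
    have h1 : ∀ i, ∑ S, θ i * h S i * h S j = θ i * if i = j then (2 : ℝ) ^ k else 0 := fun i => by
      rw [← horth, Finset.mul_sum]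
      exact Finset.sum_congr rfl fun S _ => mul_assoc _ _ _
    rw [Finset.sum_congr rfl fun i _ => h1 i, Fintype.card_finset, Fintype.card_fin]
    simp [mul_comm]

theorem sum_inner_sq_of_orthogonal {J : Type} [Fintype J] {h : J → Vec d} {N : ℝ}
    (hN : ∀ θ : Vec d, ∑ j, (inner ℝ (h j) θ : ℝ) • h j = N • θ) (g : Vec d) :
    ∑ j, (inner ℝ g (h j) : ℝ) ^ 2 = N * ‖g‖ ^ 2 := by
  have h1 := congrArg (fun z : Vec d => (inner ℝ g z : ℝ)) (hN g)
  simp only [inner_sum, inner_smul_right, real_inner_self_eq_norm_sq] at h1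
  rw [← h1]
  exact Finset.sum_congr rfl fun j _ => by rw [real_inner_comm (h j) g, sq]

variable {d : ℕ}

/-! ### Best arms and designs for the three arm sets -/

/-- For all `ε` and `δ`, some `(ε, δ)`-PAC fixed design for `X` has length
`O((d log (1/δ) + d ^ 2) / ε ^ 2)`. -/
def HasGoodDesign (X : Set (Vec d)) : Prop :=
  ∀ ε δ : ℝ, 0 < ε → ε ≤ 1 → 0 < δ → δ < 1 →
    ∃ (A : Algorithm X) (T : ℕ), A.IsFixedDesign T ∧ A.IsPAC ε δ ∧
      (T : ℝ) ≤ 68 * (d * Real.log (1 / δ) / ε ^ 2 + (d : ℝ) ^ 2 / ε ^ 2)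

theorem measurable_toLp_ite (a : ℝ) :
    Measurable fun v : Vec d => (WithLp.toLp 2 fun i => if 0 < v i then 1 else a : Vec d) := by
  refine (WithLp.measurable_toLp 2 (Fin d → ℝ)).comp (measurable_pi_lambda _ fun i => ?_)
  exact Measurable.ite (measurableSet_lt measurable_const (by fun_prop)) measurable_const
    measurable_const

theorem isBestArm_signCube :
    IsBestArm (signCube d) fun v => WithLp.toLp 2 fun i => if 0 < v i then 1 else -1 where
  measurable := measurable_toLp_ite (-1)
  mem v i := by
    change (if 0 < v i then (1 : ℝ) else -1) = -1 ∨ (if 0 < v i then (1 : ℝ) else -1) = 1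
    split_ifs <;> simp
  inner_le v x hx := by
    simp only [PiLp.inner_apply, RCLike.inner_apply, conj_trivial, PiLp.sub_apply]
    refine Finset.sum_nonpos fun i _ => ?_
    split_ifs with hv <;> rcases hx i with h | h <;> rw [h] <;> linarith

theorem isBestArm_binaryCube :
    IsBestArm (binaryCube d) fun v => WithLp.toLp 2 fun i => if 0 < v i then 1 else 0 where
  measurable := measurable_toLp_ite 0
  mem v i := by
    change (if 0 < v i then (1 : ℝ) else 0) = 0 ∨ (if 0 < v i then (1 : ℝ) else 0) = 1
    split_ifs <;> simp
  inner_le v x hx := by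
    simp only [PiLp.inner_apply, RCLike.inner_apply, conj_trivial, PiLp.sub_apply]
    refine Finset.sum_nonpos fun i _ => ?_
    split_ifs with hv <;> rcases hx i with h | h <;> rw [h] <;> linarith

theorem isBestArm_unitBall : IsBestArm (unitBall d) fun v => ‖v‖⁻¹ • v where
  measurable := measurable_norm.inv.smul measurable_id
  mem v := by
    change ‖‖v‖⁻¹ • v‖ ≤ 1
    rw [norm_smul, norm_inv, norm_norm]
    exact inv_mul_le_one
  inner_le v x hx := by
    have h1 : (inner ℝ x v : ℝ) ≤ 1 * ‖v‖ := (real_inner_le_norm x v).trans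
      (mul_le_mul_of_nonneg_right hx (norm_nonneg v))
    rw [inner_sub_left, real_inner_smul_left, real_inner_self_eq_norm_sq]
    have h2 : ‖v‖⁻¹ * ‖v‖ ^ 2 = ‖v‖ := by
      by_cases hv : ‖v‖ = 0
      · simp [hv]
      · field_simp
    linarith

theorem hasGoodDesign_signCube (hd : 1 ≤ d) : HasGoodDesign (signCube d) := by
  intro ε δ hε hε1 hδ hδ1
  obtain ⟨J, _, _, h, hsign, hcard, horth⟩ := exists_orthogonal_signs hd
  have hdR : (0 : ℝ) < d := by exact_mod_cast hd
  set N : ℝ := (Fintype.card J : ℝ)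
  have hN : 0 < N := Nat.cast_pos.2 Fintype.card_pos
  have hJ : IsLinearDesign (signCube d) h (fun j => N⁻¹ • h j) N⁻¹ :=
    { mem := hsign
      estimate := fun θ => by
        simp only [smul_comm _ N⁻¹, ← Finset.smul_sum, horth]
        exact inv_smul_smul₀ hN.ne' θ
      variance_le := fun g => by
        simp only [inner_smul_right, mul_pow, ← Finset.mul_sum, sum_inner_sq_of_orthogonal horth]
        refine le_of_eq ?_
        field_simp }
  refine exists_fixedDesign_isPAC hd
    (fun x hx => norm_le_sqrt_of_abs_le_one (abs_le_one_of_mem_signCube hx))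
    (Real.sqrt_pos.2 hdR) (inv_pos.2 hN) isBestArm_signCube hJ (by linarith) ?_ hε hε1 hδ hδ1
  rw [Real.sq_sqrt hdR.le, mul_assoc, inv_mul_cancel₀ hN.ne']
  linarith

theorem hasGoodDesign_unitBall (hd : 1 ≤ d) : HasGoodDesign (unitBall d) := by
  intro ε δ hε hε1 hδ hδ1
  obtain ⟨J, _, _, h, hsign, hcard, horth⟩ := exists_orthogonal_signs hd
  have hdR : (0 : ℝ) < d := by exact_mod_cast hd
  set N : ℝ := (Fintype.card J : ℝ)
  have hN : 0 < N := Nat.cast_pos.2 Fintype.card_pos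
  set r := √(d : ℝ) with hr
  have hr0 : 0 < r := Real.sqrt_pos.2 hdR
  have hr2 : r ^ 2 = d := Real.sq_sqrt hdR.le
  have hJ : IsLinearDesign (unitBall d) (fun j => r⁻¹ • h j) (fun j => (r / N) • h j) (d / N) :=
    { mem := fun j => by
        have h1 : ‖h j‖ ≤ r :=
          norm_le_sqrt_of_abs_le_one (abs_le_one_of_mem_signCube (hsign j))
        change ‖_‖ ≤ 1
        rw [norm_smul, norm_inv, Real.norm_of_nonneg hr0.le, inv_mul_le_iff₀ hr0, mul_one]
        exact h1
      estimate := fun θ => by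
        have h1 : ∀ j, (inner ℝ (r⁻¹ • h j) θ : ℝ) • (r / N) • h j
            = N⁻¹ • (inner ℝ (h j) θ : ℝ) • h j := fun j => by
          rw [real_inner_smul_left, smul_smul, smul_smul]
          congr 1
          field_simp
        simp only [h1, ← Finset.smul_sum, horth]
        exact inv_smul_smul₀ hN.ne' θ
      variance_le := fun g => by
        simp only [inner_smul_right, mul_pow, ← Finset.mul_sum, sum_inner_sq_of_orthogonal horth]
        refine le_of_eq ?_
        rw [div_pow, hr2]
        field_simp }
  refine exists_fixedDesign_isPAC hd (fun x hx => hx) one_pos (div_pos hdR hN)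
    isBestArm_unitBall hJ (by linarith) ?_ hε hε1 hδ hδ1
  rw [one_pow, one_mul, div_mul_cancel₀ _ hN.ne']
  linarith

/-- Each sign vector `h` is the difference of the two complementary binary vectors
`(1 + h) / 2` and `(1 - h) / 2`. -/
theorem hasGoodDesign_binaryCube (hd : 1 ≤ d) : HasGoodDesign (binaryCube d) := by
  intro ε δ hε hε1 hδ hδ1
  obtain ⟨J, _, _, h, hsign, hcard, horth⟩ := exists_orthogonal_signs hd
  have hdR : (0 : ℝ) < d := by exact_mod_cast hd
  set N : ℝ := (Fintype.card J : ℝ)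
  have hN : 0 < N := Nat.cast_pos.2 Fintype.card_pos
  have hcard2 : (Fintype.card (J × Bool) : ℝ) = 2 * N := by
    rw [Fintype.card_prod, Fintype.card_bool]; push_cast; ring
  let σ : Bool → ℝ := fun b => if b then 1 else -1
  let x : J × Bool → Vec d := fun p => WithLp.toLp 2 fun i => (1 + σ p.2 * h p.1 i) / 2
  have hxd : ∀ j, x (j, true) - x (j, false) = h j := fun j => by
    ext i
    change (1 + σ true * h j i) / 2 - (1 + σ false * h j i) / 2 = h j i
    simp only [σ, if_true, Bool.false_eq_true, if_false]
    ring
  have hJ : IsLinearDesign (binaryCube d) x (fun p => (σ p.2 * N⁻¹) • h p.1) (2 / N) :=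
    { mem := fun p i => by
        change (1 + σ p.2 * h p.1 i) / 2 = 0 ∨ (1 + σ p.2 * h p.1 i) / 2 = 1
        rcases p with ⟨j, b⟩
        rcases hsign j i with e | e <;> cases b <;> simp only [σ, e] <;> norm_num
      estimate := fun θ => by
        rw [Fintype.sum_prod_type]
        have h1 : ∀ j, ∑ b, (inner ℝ (x (j, b)) θ : ℝ) • (σ b * N⁻¹) • h j
            = N⁻¹ • (inner ℝ (h j) θ : ℝ) • h j := fun j => by
          rw [Fintype.sum_bool, ← hxd j, inner_sub_left, hxd j]
          simp only [σ, if_true, Bool.false_eq_true, if_false]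
          rw [smul_smul, smul_smul, smul_smul, ← add_smul]
          congr 1
          ring
        simp only [h1, ← Finset.smul_sum, horth]
        exact inv_smul_smul₀ hN.ne' θ
      variance_le := fun g => by
        rw [Fintype.sum_prod_type]
        have h1 : ∀ j, ∑ b, (inner ℝ g ((σ b * N⁻¹) • h j) : ℝ) ^ 2
            = 2 * N⁻¹ ^ 2 * (inner ℝ g (h j) : ℝ) ^ 2 := fun j => by
          simp only [Fintype.sum_bool, inner_smul_right, σ, if_true, Bool.false_eq_true,
            if_false]
          ring
        simp only [h1, ← Finset.mul_sum, sum_inner_sq_of_orthogonal horth]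
        refine le_of_eq ?_
        field_simp }
  refine exists_fixedDesign_isPAC hd
    (fun x hx => norm_le_sqrt_of_abs_le_one (abs_le_one_of_mem_binaryCube hx))
    (Real.sqrt_pos.2 hdR) (div_pos two_pos hN) isBestArm_binaryCube hJ ?_ ?_ hε hε1 hδ hδ1
  · rw [hcard2]; linarith
  · rw [hcard2, Real.sq_sqrt hdR.le]
    refine le_of_eq ?_
    field_simp
    norm_num

end LinearBandit

theorem mainTheorem11 :
    ∃ c C : ℝ, 0 < c ∧ 0 < C ∧
      ∀ d : ℕ, 1 ≤ d → ∀ X : Set (LinearBandit.Vec d),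
        (X = LinearBandit.unitBall d ∨ X = LinearBandit.signCube d ∨
          X = LinearBandit.binaryCube d) →
        -- a family of algorithms with `(H₁ log(1/δ) + H₂)/ε²` samples has `H₂ ≥ c d²`
        (∀ H₁ H₂ : ℝ, 0 < H₁ → H₁ ≤ H₂ →
          (∀ ε δ : ℝ, 0 < ε → ε ≤ 1 → 0 < δ → δ < 1 →
            ∃ A : LinearBandit.Algorithm X, A.IsPAC ε δ ∧
              ∀ θ : LinearBandit.Vec d,
                A.expectedSamples θ ≤
                  ENNReal.ofReal ((H₁ * Real.log (1 / δ) + H₂) / ε ^ 2)) →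
          c * (d : ℝ) ^ 2 ≤ H₂) ∧
        -- lower bound on the sample complexity of each `(ε, δ)`-PAC algorithm
        (∀ ε δ : ℝ, 0 < ε → ε ≤ 1 → 0 < δ → δ < 1 / 16 →
          ∀ A : LinearBandit.Algorithm X, A.IsPAC ε δ →
            ∃ θ : LinearBandit.Vec d,
              ENNReal.ofReal
                  (c * ((d : ℝ) * Real.log (1 / δ) / ε ^ 2 + (d : ℝ) ^ 2 / ε ^ 2)) ≤
                A.expectedSamples θ) ∧
        -- the matching upper bound, attained by non-adaptive fixed designs
        (∀ ε δ : ℝ, 0 < ε → ε ≤ 1 → 0 < δ → δ < 1 →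
          ∃ (A : LinearBandit.Algorithm X) (T : ℕ), A.IsFixedDesign T ∧ A.IsPAC ε δ ∧
            (T : ℝ) ≤ C * ((d : ℝ) * Real.log (1 / δ) / ε ^ 2 + (d : ℝ) ^ 2 / ε ^ 2)) := by
  refine ⟨1 / 10240, 68, by norm_num, by norm_num, fun d hd X hX => ?_⟩
  have hlower : ∀ ε δ : ℝ, 0 < ε → ε ≤ 1 → 0 < δ → δ < 1 / 16 →
      ∀ A : LinearBandit.Algorithm X, A.IsPAC ε δ → ∃ θ : LinearBandit.Vec d,
        ENNReal.ofReal (1 / 2560 * ((d : ℝ) * Real.log (1 / δ) / ε ^ 2 + (d : ℝ) ^ 2 / ε ^ 2)) ≤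
          A.expectedSamples θ := by
    intro ε δ hε _ hδ hδ' A hA
    rcases hX with rfl | rfl | rfl
    · exact (LinearBandit.isSignHard_unitBall hd hε).exists_le_expectedSamples hε hd hδ hδ' hA
    · exact (LinearBandit.isSignHard_signCube hd hε).exists_le_expectedSamples hε hd hδ hδ' hA
    · exact (LinearBandit.isSignHard_binaryCube hd hε).exists_le_expectedSamples hε hd hδ hδ' hA
  refine ⟨fun H₁ H₂ hH₁ hH hfam => ?_, fun ε δ hε hε1 hδ hδ' A hA => ?_, ?_⟩
  · -- at `ε = 1` and a constant `δ < 1/16`, the assumed bound is at most `4 * H₂`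
    obtain ⟨A, hA, hbound⟩ := hfam 1 (1 / 17) one_pos le_rfl (by norm_num) (by norm_num)
    obtain ⟨θ, hθ⟩ := hlower 1 (1 / 17) one_pos le_rfl (by norm_num) (by norm_num) A hA
    have hlog0 : 0 ≤ Real.log (1 / (1 / 17)) := Real.log_nonneg (by norm_num)
    have hlog3 : Real.log (1 / (1 / 17)) ≤ 3 := by
      rw [Real.log_le_iff_le_exp (by norm_num), show (3 : ℝ) = (3 : ℕ) * 1 by norm_num,
        Real.exp_nat_mul]
      calc (1 / (1 / 17) : ℝ) ≤ 2.7 ^ 3 := by norm_num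
        _ ≤ _ := pow_le_pow_left₀ (by norm_num) (by linarith [Real.exp_one_gt_d9]) 3
    have h := hθ.trans (hbound θ)
    have hd0 : (0 : ℝ) ≤ d := Nat.cast_nonneg d
    have hH₂ : 0 ≤ H₂ := hH₁.le.trans hH
    rw [ENNReal.ofReal_le_ofReal_iff (by positivity), one_pow, div_one, div_one, div_one] at h
    have h1 : H₁ * Real.log (1 / (1 / 17)) ≤ H₂ * 3 := by gcongr
    have h2 := mul_nonneg hd0 hlog0
    linarith
  · obtain ⟨θ, hθ⟩ := hlower ε δ hε hε1 hδ hδ' A hA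
    refine ⟨θ, (ENNReal.ofReal_le_ofReal ?_).trans hθ⟩
    have : 0 ≤ Real.log (1 / δ) := Real.log_nonneg (by rw [le_div_iff₀ hδ]; linarith)
    refine mul_le_mul_of_nonneg_right (by norm_num) (by positivity)
  · rcases hX with rfl | rfl | rfl
    · exact (LinearBandit.hasGoodDesign_unitBall hd)
    · exact (LinearBandit.hasGoodDesign_signCube hd)
    · exact (LinearBandit.hasGoodDesign_binaryCube hd)
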